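/- Let $\Gamma$ be a simplicial graph, let $\{G_u \mid u \in V(\Gamma)\}$ be a collection of groups (the vertex-groups) indexed by the vertices of $\Gamma$, and let $\Gamma\mathcal{G}$ be their graph product, i.e. the quotient of the free product of the $G_u$ by the normal closure of the commutators $[g,h]$ with $g \in G_u$, $h \in G_v$ and $u, v$ adjacent in $\Gamma$. Two vertex-groups $G_u$, $G_v$ are called adjacent if $u$ and $v$ are adjacent in $\Gamma$. A word $s_1\cdots s_m$ ($m \geq 0$) whose letters (syllables) are elements of vertex-groups is graphically reduced if * either $m = 1$ and $s_1 = 1$, or $s_i \neq 1$ for every $i$; and * whenever $i<j$ and $s_i$, $s_j$ belong to the same vertex-group $G$, there is some $i<k<j$ such that the vertex-group of $s_k$ is not adjacent to $G$. It is graphically cyclically reduced if moreover there are no $i<j$ such that $s_i$ and $s_j$ belong to the same vertex-group $G$ and $G$ is adjacent to the vertex-group of $s_k$ for every $k<i$ and every $k>j$. An element of $\Gamma\mathcal{G}$ is graphically cyclically reduced if all the graphically reduced words representing it are graphically cyclically reduced. A syllable $s_i$ of a word $s_1 \cdots s_m$ is floating if its vertex-group is adjacent to the vertex-group of $s_k$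 for every $k \neq i$. Theorem. Let $a,b \in \Gamma\mathcal{G}$ be two graphically cyclically reduced elements. Then $a$ and $b$ are conjugate in $\Gamma\mathcal{G}$ if and only if there exist integers $r,n\geq 0$ and graphically reduced words $x_1\cdots x_r p_1\cdots p_n$ and $y_1\cdots y_r q_1\cdots q_n$ such that * $a = x_1\cdots x_r p_1\cdots p_n$ and $b = y_1\cdots y_r q_1\cdots q_n$ in $\Gamma\mathcal{G}$; * each $p_i$ is a floating syllable of the word $x_1\cdots x_r p_1\cdots p_n$, each $q_i$ is a floating syllable of the word $y_1\cdots y_r q_1\cdots q_n$, and there exists a permutation $\sigma \in S_n$ such that, for every $1 \leq i \leq n$, $p_i$ and $q_{\sigma(i)}$ belong to a common vertex-group and are conjugate in it; * the word $y_1\cdots y_r$ can be obtained from the word $x_1\cdots x_r$ by finitely many operations, each of which either permutes two consecutive syllables belonging to adjacent vertex-groups or performs a cyclic permutation of the word. -/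

import Mathlib

universe u v

/-- The relators of the graph product: the commutators `[g, h]`, in the free product of the
vertex-groups, of elements `g`, `h` of vertex-groups indexed by adjacent vertices. -/
def graphProductRelators {V : Type u} (Γ : SimpleGraph V) (G : V → Type v) [∀ u, Group (G u)] :
    Set (Monoid.CoprodI G) :=
  {c | ∃ (u w : V) (g : G u) (h : G w), Γ.Adj u w ∧
    c = Monoid.CoprodI.of g * Monoid.CoprodI.of h *
      (Monoid.CoprodI.of g)⁻¹ * (Monoid.CoprodI.of h)⁻¹}

/-- The graph product of the groups `G u` along the simplicial graph `Γ`: the quotient of their free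
product by the normal closure of the commutators of elements of adjacent vertex-groups. -/
def GraphProduct {V : Type u} (Γ : SimpleGraph V) (G : V → Type v) [∀ u, Group (G u)] :
    Type (max u v) :=
  Monoid.CoprodI G ⧸ Subgroup.normalClosure (graphProductRelators Γ G)

namespace GraphProduct

instance instGroup {V : Type u} (Γ : SimpleGraph V) (G : V → Type v) [∀ u, Group (G u)] :
    Group (GraphProduct Γ G) :=
  inferInstanceAs (Group (Monoid.CoprodI G ⧸ Subgroup.normalClosure (graphProductRelators Γ G)))

/-- The canonical map from a vertex-group to the graph product. -/
def of {V : Type u} (Γ : SimpleGraph V) (G : V → Type v) [∀ u, Group (G u)] (u : V) :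
    G u →* GraphProduct Γ G :=
  (QuotientGroup.mk' (Subgroup.normalClosure (graphProductRelators Γ G))).comp
    (Monoid.CoprodI.of (M := G) (i := u))

/-- A syllable: a vertex `s.1` together with an element `s.2` of the vertex-group `G s.1`. Words
over the vertex-groups are lists of syllables. -/
abbrev Syllable {V : Type u} (G : V → Type v) : Type (max u v) :=
  Σ u : V, G u

/-- The element of the graph product represented by a word. -/
def eval {V : Type u} (Γ : SimpleGraph V) (G : V → Type v) [∀ u, Group (G u)]
    (w : List (Syllable G)) : GraphProduct Γ G :=
  (w.map fun s => of Γ G s.1 s.2).prod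

/-- Graphically reduced words: either the word is a single trivial syllable or no syllable is
trivial (the empty word is allowed); and between any two syllables of the same vertex-group there is
a syllable whose vertex-group is not adjacent to theirs. -/
def IsGraphicallyReduced {V : Type u} (Γ : SimpleGraph V) (G : V → Type v) [∀ u, Group (G u)]
    (w : List (Syllable G)) : Prop :=
  ((∃ u : V, w = [⟨u, 1⟩]) ∨ ∀ s ∈ w, s.2 ≠ 1) ∧
  ∀ (i j : ℕ) (hij : i < j) (hj : j < w.length), w[i].1 = w[j].1 →
    ∃ (k : ℕ) (_ : i < k) (_ : k < j), ¬ Γ.Adj w[k].1 w[i].1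

/-- Graphically cyclically reduced words: graphically reduced words without two distinct syllables
of the same vertex-group such that the first one can be shuffled to the beginning of the word and
the second one can be shuffled to the end of the word. -/
def IsGraphicallyCyclicallyReduced {V : Type u} (Γ : SimpleGraph V) (G : V → Type v)
    [∀ u, Group (G u)] (w : List (Syllable G)) : Prop :=
  IsGraphicallyReduced Γ G w ∧
  ¬ ∃ (i j : ℕ) (_ : i < j) (_ : j < w.length), w[i].1 = w[j].1 ∧
    (∀ (k : ℕ) (_ : k < i), Γ.Adj w[i].1 w[k].1) ∧
    (∀ (k : ℕ) (_ : j < k) (_ : k < w.length), Γ.Adj w[j].1 w[k].1)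

/-- An element of the graph product is graphically cyclically reduced if all the graphically reduced
words representing it are graphically cyclically reduced. -/
def IsGraphicallyCyclicallyReducedElement {V : Type u} (Γ : SimpleGraph V) (G : V → Type v)
    [∀ u, Group (G u)] (a : GraphProduct Γ G) : Prop :=
  ∀ w : List (Syllable G), IsGraphicallyReduced Γ G w → eval Γ G w = a →
    IsGraphicallyCyclicallyReduced Γ G w

/-- The `i`-th syllable (counted from `0`) of the word `w` is floating: its vertex-group is adjacent
to the vertex-group of every other syllable of `w`. -/
def IsFloating {V : Type u} (Γ : SimpleGraph V) (G : V → Type v) (w : List (Syllable G)) (i : ℕ) :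
    Prop :=
  ∃ _ : i < w.length, ∀ (k : ℕ) (_ : k < w.length), k ≠ i → Γ.Adj w[i].1 w[k].1

/-- Two syllables belong to a common vertex-group and are conjugate in it. -/
def ConjInVertexGroup {V : Type u} (G : V → Type v) [∀ u, Group (G u)] (s t : Syllable G) : Prop :=
  ∃ (u : V) (g h : G u), s = ⟨u, g⟩ ∧ t = ⟨u, h⟩ ∧ IsConj g h

/-- The elementary moves on words: permuting two consecutive syllables which belong to adjacent
vertex-groups, and performing a cyclic permutation. -/
inductive CyclicMove {V : Type u} (Γ : SimpleGraph V) (G : V → Type v) :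
    List (Syllable G) → List (Syllable G) → Prop
  | swap (l l' : List (Syllable G)) (s t : Syllable G) (hst : Γ.Adj s.1 t.1) :
      CyclicMove Γ G (l ++ s :: t :: l') (l ++ t :: s :: l')
  | rotate (l l' : List (Syllable G)) : CyclicMove Γ G (l ++ l') (l' ++ l)

/-- The second word can be obtained from the first one by finitely many elementary moves. -/
def CyclicallyRelated {V : Type u} (Γ : SimpleGraph V) (G : V → Type v) :
    List (Syllable G) → List (Syllable G) → Prop :=
  Relation.ReflTransGen (CyclicMove Γ G)

end GraphProduct

/-! Left multiplication by the vertex-groups is a well-defined action on reduced words up to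
shuffling, so two reduced words for the same element differ only by shuffles (`Red.shuffle`). Hence
the syllable length `len` and the left-end syllable `head u` are invariants of elements, and `head u
c⁻¹` reads off the right end of `c`, up to inversion.

Conjugation by an element of `G u` is governed by these two ends. Outside the subgroup `star Γ G u`
they change independently (`len_conj_add`); inside it, only one syllable is conjugated within `G u`.
It follows that peaks in the graph of such conjugations can be bypassed (`conj_confluent`). Peak
reduction (`reflTransGen_levelStep`) then joins conjugate elements that are locally of minimal
length by a path of such elements of constant length. Graphically cyclically reduced elements are
locally minimal, since a shortening conjugation would exhibit a reduced word that begins and ends in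
the same vertex-group.

Up to shuffling, a step of this path either rotates a word or conjugates a floating syllable in its
vertex-group (`LevelStep.wordMove`). Neither changes the multiset of vertices, so the set of
floating vertices is constant along the path. The word therefore splits: its floating part evolves
by conjugacy and reordering, the rest by swaps and rotations (`restrict_of_wordMoves`).

Conversely, floating syllables commute with all the other syllables, so the two parts can be
conjugated independently of each other. -/

set_option linter.unusedSectionVars false

namespace GraphProduct

variable {V : Type u} {Γ : SimpleGraph V} {G : V → Type v} [∀ u, Group (G u)]

/-! ### Reduced words, shuffles, and left multiplication by a vertex-group -/

section Words

variable (Γ)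

open Classical in
/-- The first syllable of `w` in the vertex-group of `u`, provided that it can be shuffled to the
front (and `1` otherwise), together with the rest of the word. -/
noncomputable def splitHead (u : V) : List (Syllable G) → G u × List (Syllable G)
  | [] => (1, [])
  | s :: w =>
    if h : s.1 = u then (h ▸ s.2, w)
    else if Γ.Adj u s.1 then ((splitHead u w).1, s :: (splitHead u w).2)
    else (1, s :: w)

@[simp] lemma splitHead_nil (u : V) : splitHead Γ u ([] : List (Syllable G)) = (1, []) := rfl

@[simp] lemma splitHead_cons_self (u : V) (g : G u) (w : List (Syllable G)) :
    splitHead Γ u (⟨u, g⟩ :: w) = (g, w) := by simp [splitHead]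

variable {Γ} in
lemma splitHead_cons_adj {u : V} {s : Syllable G} (h : Γ.Adj u s.1) (w : List (Syllable G)) :
    splitHead Γ u (s :: w) = ((splitHead Γ u w).1, s :: (splitHead Γ u w).2) := by
  simp [splitHead, h, h.ne']

variable {Γ} in
lemma splitHead_cons_not_adj {u : V} {s : Syllable G} (hne : s.1 ≠ u) (h : ¬ Γ.Adj u s.1)
    (w : List (Syllable G)) : splitHead Γ u (s :: w) = (1, s :: w) := by
  simp [splitHead, h, hne]

lemma syllable_cases (u : V) (s : Syllable G) :
    (∃ g : G u, s = ⟨u, g⟩) ∨ Γ.Adj u s.1 ∨ (s.1 ≠ u ∧ ¬ Γ.Adj u s.1) := by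
  obtain ⟨v, g⟩ := s
  by_cases h : v = u
  · subst h; exact Or.inl ⟨g, rfl⟩
  · by_cases h' : Γ.Adj u v
    · exact Or.inr (Or.inl h')
    · exact Or.inr (Or.inr ⟨h, h'⟩)

/-- Reduced words, defined recursively; the trivial syllable is excluded. -/
def Red : List (Syllable G) → Prop
  | [] => True
  | s :: w => s.2 ≠ 1 ∧ (splitHead Γ s.1 w).1 = 1 ∧ Red w

/-- Two words are shuffle-equivalent if they differ by permutations of consecutive adjacent
syllables. -/
inductive Shuffle : List (Syllable G) → List (Syllable G) → Prop
  | nil : Shuffle [] []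
  | cons (s : Syllable G) {w w' : List (Syllable G)} : Shuffle w w' → Shuffle (s :: w) (s :: w')
  | swap {s t : Syllable G} (h : Γ.Adj s.1 t.1) (w : List (Syllable G)) :
      Shuffle (s :: t :: w) (t :: s :: w)
  | trans {w₁ w₂ w₃ : List (Syllable G)} : Shuffle w₁ w₂ → Shuffle w₂ w₃ → Shuffle w₁ w₃

variable {Γ}

lemma Shuffle.refl (w : List (Syllable G)) : Shuffle Γ w w := by
  induction w with
  | nil => exact .nil
  | cons s w ih => exact .cons s ih

lemma Shuffle.symm {w w' : List (Syllable G)} (h : Shuffle Γ w w') : Shuffle Γ w' w := by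
  induction h with
  | nil => exact .nil
  | cons s _ ih => exact .cons s ih
  | swap h w => exact .swap h.symm w
  | trans _ _ ih₁ ih₂ => exact .trans ih₂ ih₁

lemma Shuffle.perm {w w' : List (Syllable G)} (h : Shuffle Γ w w') : w.Perm w' := by
  induction h with
  | nil => exact .nil
  | cons s _ ih => exact .cons s ih
  | swap h w => exact .swap _ _ w
  | trans _ _ ih₁ ih₂ => exact .trans ih₁ ih₂

lemma Shuffle.cyclicallyRelated_append {w w' : List (Syllable G)} (h : Shuffle Γ w w')
    (l : List (Syllable G)) : CyclicallyRelated Γ G (l ++ w) (l ++ w') := by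
  induction h generalizing l with
  | nil => exact .refl
  | cons s _ ih => simpa using ih (l ++ [s])
  | swap h w => exact .single (.swap l w _ _ h)
  | trans _ _ ih₁ ih₂ => exact (ih₁ l).trans (ih₂ l)

lemma Shuffle.cyclicallyRelated {w w' : List (Syllable G)} (h : Shuffle Γ w w') :
    CyclicallyRelated Γ G w w' :=
  h.cyclicallyRelated_append []

/-- This makes the head syllable an invariant of shuffle classes. Swapping `s` and `t` cannot
unblock a head: if `s` blocks `u`, then `t`, being adjacent to `s`, cannot lie in the vertex-group
of `u`. -/
lemma Shuffle.splitHead (u : V) {w w' : List (Syllable G)} (h : Shuffle Γ w w') :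
    (splitHead Γ u w).1 = (splitHead Γ u w').1 ∧
      Shuffle Γ (splitHead Γ u w).2 (splitHead Γ u w').2 := by
  induction h with
  | nil => exact ⟨rfl, .nil⟩
  | trans _ _ ih₁ ih₂ => exact ⟨ih₁.1.trans ih₂.1, ih₁.2.trans ih₂.2⟩
  | cons s h ih =>
    rcases syllable_cases Γ u s with ⟨g, rfl⟩ | hs | ⟨hs, hs'⟩
    · simpa using h
    · simpa [splitHead_cons_adj hs] using ⟨ih.1, ih.2.cons s⟩
    · simpa [splitHead_cons_not_adj hs hs'] using h.cons s
  | @swap s t h w =>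
    rcases syllable_cases Γ u s with ⟨g, rfl⟩ | hs | ⟨hs, hs'⟩
    · simpa [splitHead_cons_adj h] using Shuffle.refl _
    · rcases syllable_cases Γ u t with ⟨g, rfl⟩ | ht | ⟨ht, ht'⟩
      · simpa [splitHead_cons_adj hs] using Shuffle.refl _
      · simpa [splitHead_cons_adj hs, splitHead_cons_adj ht] using Shuffle.swap h _
      · simpa [splitHead_cons_adj hs, splitHead_cons_not_adj ht ht'] using Shuffle.swap h _
    · rcases syllable_cases Γ u t with ⟨g, rfl⟩ | ht | ⟨ht, ht'⟩
      · exact absurd h.symm hs'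
      · simpa [splitHead_cons_adj ht, splitHead_cons_not_adj hs hs'] using Shuffle.swap h _
      · simpa [splitHead_cons_not_adj ht ht', splitHead_cons_not_adj hs hs'] using Shuffle.swap h _

lemma Shuffle.red {w w' : List (Syllable G)} (h : Shuffle Γ w w') (hw : Red Γ w) : Red Γ w' := by
  induction h with
  | nil => exact hw
  | trans _ _ ih₁ ih₂ => exact ih₂ (ih₁ hw)
  | cons s h ih => exact ⟨hw.1, (h.splitHead s.1).1 ▸ hw.2.1, ih hw.2.2⟩
  | swap h w =>
    obtain ⟨h₁, h₂, h₃, h₄, h₅⟩ := hw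
    rw [splitHead_cons_adj h] at h₂
    refine ⟨h₃, ?_, h₁, h₂, h₅⟩
    rw [splitHead_cons_adj h.symm]
    exact h₄

/-- As `u` and `v` are adjacent, a syllable at `u` never blocks one at `v`, nor conversely, so the
two extractions are independent. The commutation of the actions of adjacent vertex-groups rests on
this. -/
lemma splitHead_splitHead {u v : V} (h : Γ.Adj u v) (w : List (Syllable G)) :
    splitHead Γ v (splitHead Γ u w).2 =
      ((splitHead Γ v w).1, (splitHead Γ u (splitHead Γ v w).2).2) := by
  induction w with
  | nil => rfl
  | cons s w ih =>
    rcases syllable_cases Γ u s with ⟨g, rfl⟩ | hs | ⟨hs, hs'⟩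
    · simp [splitHead_cons_adj (s := ⟨u, g⟩) h.symm]
    · rcases syllable_cases Γ v s with ⟨g, rfl⟩ | ht | ⟨ht, ht'⟩
      · simp [splitHead_cons_adj hs]
      · simp [splitHead_cons_adj hs, splitHead_cons_adj ht, ih]
      · simp [splitHead_cons_adj hs, splitHead_cons_not_adj ht ht']
    · rcases syllable_cases Γ v s with ⟨g, rfl⟩ | ht | ⟨ht, ht'⟩
      · exact absurd h hs'
      · simp [splitHead_cons_adj ht, splitHead_cons_not_adj hs hs']
      · simp [splitHead_cons_not_adj ht ht', splitHead_cons_not_adj hs hs']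

lemma mem_of_mem_splitHead {u : V} {w : List (Syllable G)} {s : Syllable G}
    (h : s ∈ (splitHead Γ u w).2) : s ∈ w := by
  induction w with
  | nil => exact h
  | cons t w ih =>
    rcases syllable_cases Γ u t with ⟨g, rfl⟩ | ht | ⟨ht, ht'⟩
    · simp only [splitHead_cons_self] at h; exact List.mem_cons_of_mem _ h
    · simp only [splitHead_cons_adj ht, List.mem_cons] at h ⊢; exact h.imp_right ih
    · simpa only [splitHead_cons_not_adj ht ht'] using h

/-- A second extractable syllable at `u` could be shuffled next to the first, which reducedness
forbids. -/
lemma Red.splitHead_snd (u : V) {w : List (Syllable G)} (h : Red Γ w) :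
    Red Γ (splitHead Γ u w).2 ∧ (splitHead Γ u (splitHead Γ u w).2).1 = 1 := by
  induction w with
  | nil => exact ⟨trivial, rfl⟩
  | cons s w ih =>
    rcases syllable_cases Γ u s with ⟨g, rfl⟩ | hs | ⟨hs, hs'⟩
    · simpa using h.2.symm
    · simp only [splitHead_cons_adj hs]
      exact ⟨⟨h.1, by rw [splitHead_splitHead hs]; exact h.2.1, (ih h.2.2).1⟩, (ih h.2.2).2⟩
    · simp only [splitHead_cons_not_adj hs hs']; exact ⟨h, trivial⟩

/-- The default value `1` of `splitHead` is unambiguous on reduced words, whose syllables are all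
nontrivial. -/
lemma Red.splitHead_cases (u : V) {w : List (Syllable G)} (h : Red Γ w) :
    ((splitHead Γ u w).1 = 1 ∧ (splitHead Γ u w).2 = w) ∨
      ((splitHead Γ u w).1 ≠ 1 ∧
        Shuffle Γ w (⟨u, (splitHead Γ u w).1⟩ :: (splitHead Γ u w).2)) := by
  induction w with
  | nil => exact Or.inl ⟨rfl, rfl⟩
  | cons s w ih =>
    rcases syllable_cases Γ u s with ⟨g, rfl⟩ | hs | ⟨hs, hs'⟩
    · simp only [splitHead_cons_self]; exact Or.inr ⟨h.1, .refl _⟩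
    · simp only [splitHead_cons_adj hs]
      refine (ih h.2.2).imp (fun h => ⟨h.1, by rw [h.2]⟩) fun h => ⟨h.1, ?_⟩
      exact (h.2.cons s).trans (.swap hs.symm _)
    · simp only [splitHead_cons_not_adj hs hs']; exact Or.inl ⟨trivial, trivial⟩

lemma Red.splitHead_eq_of_fst {u : V} {w : List (Syllable G)} (h : Red Γ w)
    (h₁ : (splitHead Γ u w).1 = 1) : splitHead Γ u w = (1, w) := by
  rcases h.splitHead_cases u with h | h
  · exact Prod.ext h.1 h.2
  · exact absurd h₁ h.1

/-- The empty word if `g = 1`, and the word with the single syllable `g` otherwise. -/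
noncomputable def syl {u : V} (g : G u) : List (Syllable G) :=
  open Classical in if g = 1 then [] else [⟨u, g⟩]

@[simp] lemma syl_one (u : V) : syl (1 : G u) = [] := by simp [syl]

lemma syl_of_ne {u : V} {g : G u} (h : g ≠ 1) : syl g = [⟨u, g⟩] := by simp [syl, h]

lemma syl_cases {u : V} (g : G u) : (g = 1 ∧ syl g = []) ∨ (g ≠ 1 ∧ syl g = [⟨u, g⟩]) := by
  by_cases h : g = 1 <;> simp [syl, h]

variable (Γ) in
/-- Left multiplication of a reduced word by an element of a vertex-group. -/
noncomputable def lmul {u : V} (g : G u) (w : List (Syllable G)) : List (Syllable G) :=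
  syl (g * (splitHead Γ u w).1) ++ (splitHead Γ u w).2

lemma lmul_of_fst {u : V} {g : G u} {w : List (Syllable G)} (h : Red Γ w)
    (h₁ : (splitHead Γ u w).1 = 1) : lmul Γ g w = syl g ++ w := by
  simp [lmul, h.splitHead_eq_of_fst h₁]

lemma Red.syl_append {u : V} {g : G u} {w : List (Syllable G)} (h : Red Γ w)
    (h₁ : (splitHead Γ u w).1 = 1) : Red Γ (syl g ++ w) := by
  rcases syl_cases g with ⟨_, e⟩ | ⟨hg, e⟩ <;> rw [e]
  · exact h
  · exact ⟨hg, h₁, h⟩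

lemma splitHead_syl_append {u : V} {g : G u} {w : List (Syllable G)} (h : Red Γ w)
    (h₁ : (splitHead Γ u w).1 = 1) : splitHead Γ u (syl g ++ w) = (g, w) := by
  rcases syl_cases g with ⟨hg, e⟩ | ⟨hg, e⟩ <;> rw [e]
  · rw [hg]; exact h.splitHead_eq_of_fst h₁
  · simp

lemma splitHead_syl_append_adj {u v : V} (huv : Γ.Adj u v) (g : G v) (w : List (Syllable G)) :
    splitHead Γ u (syl g ++ w) = ((splitHead Γ u w).1, syl g ++ (splitHead Γ u w).2) := by
  rcases syl_cases g with ⟨_, e⟩ | ⟨_, e⟩ <;> rw [e]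
  · simp
  · simp [splitHead_cons_adj (s := ⟨v, g⟩) huv]

lemma Red.lmul {u : V} (g : G u) {w : List (Syllable G)} (h : Red Γ w) : Red Γ (lmul Γ g w) :=
  (h.splitHead_snd u).1.syl_append (h.splitHead_snd u).2

lemma Red.splitHead_lmul {u : V} (g : G u) {w : List (Syllable G)} (h : Red Γ w) :
    GraphProduct.splitHead Γ u (GraphProduct.lmul Γ g w) =
      (g * (GraphProduct.splitHead Γ u w).1, (GraphProduct.splitHead Γ u w).2) :=
  splitHead_syl_append (h.splitHead_snd u).1 (h.splitHead_snd u).2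

lemma splitHead_lmul_adj {u v : V} (huv : Γ.Adj u v) (g : G v) (w : List (Syllable G)) :
    splitHead Γ u (lmul Γ g w) = ((splitHead Γ u w).1, lmul Γ g (splitHead Γ u w).2) := by
  rw [lmul, splitHead_syl_append_adj huv, splitHead_splitHead huv.symm, lmul,
    splitHead_splitHead huv]

lemma Red.lmul_mul {u : V} (g h : G u) {w : List (Syllable G)} (hw : Red Γ w) :
    GraphProduct.lmul Γ (g * h) w = GraphProduct.lmul Γ g (GraphProduct.lmul Γ h w) := by
  conv_rhs => rw [GraphProduct.lmul, hw.splitHead_lmul]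
  simp [GraphProduct.lmul, mul_assoc]

/-- Equality can fail, because `lmul` leaves the syllable at `u` at the front; this is one reason
for passing to shuffle classes. -/
lemma Red.lmul_one (u : V) {w : List (Syllable G)} (hw : Red Γ w) :
    Shuffle Γ (GraphProduct.lmul Γ (1 : G u) w) w := by
  rcases hw.splitHead_cases u with h | h
  · simpa [GraphProduct.lmul, h] using Shuffle.refl w
  · simpa [GraphProduct.lmul, syl_of_ne h.1] using h.2.symm

lemma Shuffle.append_left (l : List (Syllable G)) {w w' : List (Syllable G)}
    (h : Shuffle Γ w w') : Shuffle Γ (l ++ w) (l ++ w') := by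
  induction l with
  | nil => exact h
  | cons s l ih => exact ih.cons s

lemma Shuffle.lmul {u : V} (g : G u) {w w' : List (Syllable G)} (h : Shuffle Γ w w') :
    Shuffle Γ (lmul Γ g w) (GraphProduct.lmul Γ g w') := by
  unfold GraphProduct.lmul
  rw [(h.splitHead u).1]
  exact (h.splitHead u).2.append_left _

lemma lmul_comm {u v : V} (huv : Γ.Adj u v) (g : G u) (h : G v) (w : List (Syllable G)) :
    Shuffle Γ (lmul Γ g (lmul Γ h w)) (lmul Γ h (lmul Γ g w)) := by
  have e₁ : lmul Γ g (lmul Γ h w) = syl (g * (splitHead Γ u w).1) ++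
      (syl (h * (splitHead Γ v w).1) ++ (splitHead Γ v (splitHead Γ u w).2).2) := by
    rw [lmul, splitHead_lmul_adj huv, lmul, splitHead_splitHead huv]
  have e₂ : lmul Γ h (lmul Γ g w) = syl (h * (splitHead Γ v w).1) ++
      (syl (g * (splitHead Γ u w).1) ++ (splitHead Γ v (splitHead Γ u w).2).2) := by
    rw [lmul, splitHead_lmul_adj huv.symm, lmul, splitHead_splitHead huv.symm,
      splitHead_splitHead huv]
  rw [e₁, e₂]
  rcases syl_cases (g * (splitHead Γ u w).1) with ⟨_, e⟩ | ⟨_, e⟩ <;>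
    rcases syl_cases (h * (splitHead Γ v w).1) with ⟨_, e'⟩ | ⟨_, e'⟩ <;> rw [e, e']
  · exact .refl _
  · exact .refl _
  · exact .refl _
  · exact .swap huv _

end Words

/-! ### The normal form theorem -/

section Action

variable (Γ G)

/-- The setoid of reduced words up to shuffle. -/
def redSetoid : Setoid {w : List (Syllable G) // Red Γ w} where
  r w w' := Shuffle Γ w.1 w'.1
  iseqv := ⟨fun _ => .refl _, .symm, .trans⟩

/-- Reduced words up to shuffle. -/
def NormalForm : Type (max u v) := Quotient (redSetoid Γ G)

/-- The action of a vertex-group on the normal forms. -/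
noncomputable def vertexAction (u : V) : G u →* Function.End (NormalForm Γ G) where
  toFun g := Quotient.map (sa := redSetoid Γ G) (sb := redSetoid Γ G)
    (fun w => ⟨lmul Γ g w.1, w.2.lmul g⟩) fun _ _ h => Shuffle.lmul g h
  map_one' := by
    funext x
    induction x using Quotient.inductionOn with
    | h w => exact Quotient.sound (s := redSetoid Γ G) (w.2.lmul_one u)
  map_mul' g h := by
    funext x
    induction x using Quotient.inductionOn with
    | h w => exact congrArg (Quotient.mk (redSetoid Γ G)) (Subtype.ext (w.2.lmul_mul g h))

lemma vertexAction_comm {u v : V} (h : Γ.Adj u v) (g : G u) (k : G v) :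
    vertexAction Γ G u g * vertexAction Γ G v k = vertexAction Γ G v k * vertexAction Γ G u g := by
  funext x
  induction x using Quotient.inductionOn with
  | h w => exact Quotient.sound (s := redSetoid Γ G) (lmul_comm h g k w.1)

/-- The action of the graph product on the normal forms. -/
noncomputable def action : GraphProduct Γ G →* Function.End (NormalForm Γ G) :=
  QuotientGroup.lift _ (Monoid.CoprodI.lift (vertexAction Γ G)) <| by
    refine Subgroup.normalClosure_le_normal ?_
    rintro _ ⟨u, w, g, h, huw, rfl⟩
    rw [SetLike.mem_coe, MonoidHom.mem_ker, ← map_inv, ← map_inv]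
    simp only [map_mul, Monoid.CoprodI.lift_of]
    rw [vertexAction_comm Γ G huw, mul_assoc (vertexAction Γ G w h), ← map_mul]
    simp [← map_mul]

variable {Γ G}

lemma action_of {u : V} (g : G u) : action Γ G (of Γ G u g) = vertexAction Γ G u g := by
  change Monoid.CoprodI.lift (vertexAction Γ G) (Monoid.CoprodI.of g) = _
  simp

@[simp] lemma eval_nil : eval Γ G [] = 1 := rfl

@[simp] lemma eval_cons (s : Syllable G) (w : List (Syllable G)) :
    eval Γ G (s :: w) = of Γ G s.1 s.2 * eval Γ G w := by simp [eval]

@[simp] lemma eval_append (w w' : List (Syllable G)) :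
    eval Γ G (w ++ w') = eval Γ G w * eval Γ G w' := by simp [eval]

lemma commute_of {u v : V} (h : Γ.Adj u v) (g : G u) (k : G v) :
    Commute (of Γ G u g) (of Γ G v k) := by
  have key := (QuotientGroup.eq_one_iff _).2 (Subgroup.subset_normalClosure
    (show Monoid.CoprodI.of g * Monoid.CoprodI.of k * (Monoid.CoprodI.of g)⁻¹ *
      (Monoid.CoprodI.of k)⁻¹ ∈ graphProductRelators Γ G from ⟨u, v, g, k, h, rfl⟩))
  have key' : of Γ G u g * of Γ G v k * (of Γ G u g)⁻¹ * (of Γ G v k)⁻¹ = 1 := key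
  rw [mul_inv_eq_one, mul_inv_eq_iff_eq_mul] at key'
  exact key'

lemma Shuffle.eval {w w' : List (Syllable G)} (h : Shuffle Γ w w') :
    eval Γ G w = GraphProduct.eval Γ G w' := by
  induction h with
  | nil => rfl
  | trans _ _ ih₁ ih₂ => exact ih₁.trans ih₂
  | cons s _ ih => simp [ih]
  | swap h w => simp only [eval_cons, ← mul_assoc, (commute_of h _ _).eq]

@[simp] lemma eval_syl {u : V} (g : G u) : eval Γ G (syl g) = of Γ G u g := by
  rcases syl_cases g with ⟨h, e⟩ | ⟨h, e⟩ <;> simp [e, h]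

lemma Red.eval_lmul {u : V} (g : G u) {w : List (Syllable G)} (h : Red Γ w) :
    eval Γ G (GraphProduct.lmul Γ g w) = of Γ G u g * eval Γ G w := by
  rcases h.splitHead_cases u with h | h
  · simp [GraphProduct.lmul, h]
  · rw [h.2.eval]; simp [GraphProduct.lmul, mul_assoc]

lemma Red.lmul_eq_cons {s : Syllable G} {w : List (Syllable G)} (h : Red Γ (s :: w)) :
    GraphProduct.lmul Γ s.2 w = s :: w := by
  rw [lmul_of_fst h.2.2 h.2.1, syl_of_ne h.1]; rfl

/-- Acting on the empty word recovers a reduced word, up to shuffling, from the element it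
represents: its syllables are prepended one by one without ever merging. -/
lemma Red.action_eval {w : List (Syllable G)} (h : Red Γ w) :
    action Γ G (eval Γ G w) (Quotient.mk (redSetoid Γ G) ⟨[], trivial⟩) =
      Quotient.mk (redSetoid Γ G) ⟨w, h⟩ := by
  induction w with
  | nil => simp; rfl
  | cons s w ih =>
    rw [eval_cons, map_mul]
    refine (congrArg (action Γ G (of Γ G s.1 s.2)) (ih h.2.2)).trans ?_
    rw [action_of]
    exact congrArg (Quotient.mk (redSetoid Γ G)) (Subtype.ext h.lmul_eq_cons)

/-- The normal form theorem: reduced words representing the same element are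
shuffle-equivalent. -/
theorem Red.shuffle {w w' : List (Syllable G)} (h : Red Γ w) (h' : Red Γ w')
    (e : eval Γ G w = eval Γ G w') : Shuffle Γ w w' := by
  have := h.action_eval
  rw [e, h'.action_eval] at this
  exact (Quotient.exact (s := redSetoid Γ G) this).symm

end Action

/-! ### Length, end syllables, and conjugation by vertex-groups -/

section Elements

variable (Γ) in
/-- The reduced word obtained by multiplying the syllables of a word one after the other. -/
noncomputable def nf (w : List (Syllable G)) : List (Syllable G) :=
  w.foldr (fun s l => lmul Γ s.2 l) []

@[simp] lemma nf_nil : nf Γ ([] : List (Syllable G)) = [] := rfl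

@[simp] lemma nf_cons (s : Syllable G) (w : List (Syllable G)) :
    nf Γ (s :: w) = lmul Γ s.2 (nf Γ w) := rfl

lemma red_nf (w : List (Syllable G)) : Red Γ (nf Γ w) := by
  induction w with
  | nil => trivial
  | cons s w ih => exact ih.lmul s.2

lemma eval_nf (w : List (Syllable G)) : eval Γ G (nf Γ w) = eval Γ G w := by
  induction w with
  | nil => rfl
  | cons s w ih => rw [nf_cons, (red_nf w).eval_lmul, ih, eval_cons]

lemma mem_lmul {u : V} {g : G u} {w : List (Syllable G)} {s : Syllable G}
    (h : s ∈ lmul Γ g w) : s.1 = u ∨ s ∈ w := by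
  rcases List.mem_append.1 h with h | h
  · rcases syl_cases (g * (splitHead Γ u w).1) with ⟨_, e⟩ | ⟨_, e⟩ <;> rw [e] at h
    · simp at h
    · rw [List.mem_singleton] at h; exact Or.inl (by rw [h])
  · exact Or.inr (mem_of_mem_splitHead h)

lemma nf_support {P : V → Prop} {w : List (Syllable G)} (h : ∀ s ∈ w, P s.1) :
    ∀ s ∈ nf Γ w, P s.1 := by
  induction w with
  | nil => simp
  | cons t w ih =>
    intro s hs
    rcases mem_lmul hs with h' | h'
    · rw [h']; exact h t (by simp)
    · exact ih (fun s hs => h s (by simp [hs])) s h'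

lemma exists_eval (c : GraphProduct Γ G) : ∃ w, eval Γ G w = c := by
  obtain ⟨x, rfl⟩ := QuotientGroup.mk_surjective c
  induction x using Monoid.CoprodI.induction_on with
  | one => exact ⟨[], rfl⟩
  | of i g => exact ⟨[⟨i, g⟩], by simp; rfl⟩
  | mul x y hx hy =>
    obtain ⟨w, hw⟩ := hx
    obtain ⟨w', hw'⟩ := hy
    exact ⟨w ++ w', by rw [eval_append, hw, hw']; rfl⟩

lemma exists_red (c : GraphProduct Γ G) : ∃ w, Red Γ w ∧ eval Γ G w = c := by
  obtain ⟨w, rfl⟩ := exists_eval c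
  exact ⟨nf Γ w, red_nf w, eval_nf w⟩

/-- A reduced word representing a given element. -/
noncomputable def word (c : GraphProduct Γ G) : List (Syllable G) := (exists_red c).choose

lemma red_word (c : GraphProduct Γ G) : Red Γ (word c) := (exists_red c).choose_spec.1

@[simp] lemma eval_word (c : GraphProduct Γ G) : eval Γ G (word c) = c :=
  (exists_red c).choose_spec.2

lemma Red.shuffle_word {w : List (Syllable G)} (h : Red Γ w) {c : GraphProduct Γ G}
    (e : eval Γ G w = c) : Shuffle Γ w (word c) :=
  h.shuffle (red_word c) (by simp [e])

/-- The syllable length of an element. -/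
noncomputable def len (c : GraphProduct Γ G) : ℕ := (word c).length

/-- The first syllable of `c` in the vertex-group of `u` (or `1` if there is none). -/
noncomputable def head (u : V) (c : GraphProduct Γ G) : G u := (splitHead Γ u (word c)).1

lemma Red.len_eval {w : List (Syllable G)} (h : Red Γ w) : len (eval Γ G w) = w.length :=
  (h.shuffle_word rfl).perm.length_eq.symm

lemma Red.head_eval (u : V) {w : List (Syllable G)} (h : Red Γ w) :
    head u (eval Γ G w) = (splitHead Γ u w).1 :=
  ((h.shuffle_word rfl).splitHead u).1.symm

lemma length_splitHead (u : V) (w : List (Syllable G)) :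
    (splitHead Γ u w).2.length ≤ w.length := by
  induction w with
  | nil => rfl
  | cons t w ih =>
    rcases syllable_cases Γ u t with ⟨g, rfl⟩ | ht | ⟨ht, ht'⟩
    · simp
    · simpa [splitHead_cons_adj ht] using ih
    · simp [splitHead_cons_not_adj ht ht']

/-- The number of syllables of the reduced word representing an element of a vertex-group. -/
noncomputable def wt {u : V} (g : G u) : ℕ := open Classical in if g = 1 then 0 else 1

@[simp] lemma wt_one (u : V) : wt (1 : G u) = 0 := by simp [wt]

lemma wt_of_ne {u : V} {g : G u} (h : g ≠ 1) : wt g = 1 := by simp [wt, h]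

lemma wt_le {u : V} (g : G u) : wt g ≤ 1 := by unfold wt; split <;> simp

lemma wt_eq_zero {u : V} {g : G u} : wt g = 0 ↔ g = 1 := by simp [wt]

lemma length_syl {u : V} (g : G u) : (syl g).length = wt g := by
  unfold syl wt; split <;> simp

lemma Red.length_splitHead_add {w : List (Syllable G)} (h : Red Γ w) (u : V) :
    (GraphProduct.splitHead Γ u w).2.length + wt (GraphProduct.splitHead Γ u w).1 = w.length := by
  rcases h.splitHead_cases u with h | h
  · rw [h.1, h.2]; simp
  · rw [h.2.perm.length_eq, wt_of_ne h.1]; simp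

/-- Only the head changes, from `head u c` to `g * head u c`. The additive form avoids truncated
subtraction. -/
lemma len_of_mul_add {u : V} (g : G u) (c : GraphProduct Γ G) :
    len (of Γ G u g * c) + wt (head u c) = len c + wt (g * head u c) := by
  obtain ⟨w, hw, rfl⟩ := exists_red c
  rw [← hw.eval_lmul, (hw.lmul g).len_eval, hw.len_eval, hw.head_eval]
  have := hw.length_splitHead_add u
  simp only [lmul, List.length_append, length_syl]
  omega

lemma head_of_mul {u : V} (g : G u) (c : GraphProduct Γ G) :
    head u (of Γ G u g * c) = g * head u c := by
  obtain ⟨w, hw, rfl⟩ := exists_red c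
  rw [← hw.eval_lmul, (hw.lmul g).head_eval, hw.head_eval, hw.splitHead_lmul]

lemma head_of_mul_adj {u v : V} (h : Γ.Adj u v) (g : G v) (c : GraphProduct Γ G) :
    head u (of Γ G v g * c) = head u c := by
  obtain ⟨w, hw, rfl⟩ := exists_red c
  rw [← hw.eval_lmul, (hw.lmul g).head_eval, hw.head_eval, splitHead_lmul_adj h]

lemma length_nf_le (w : List (Syllable G)) : (nf Γ w).length ≤ w.length := by
  induction w with
  | nil => rfl
  | cons s w ih =>
    have := length_splitHead (Γ := Γ) s.1 (nf Γ w)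
    have := wt_le (s.2 * (splitHead Γ s.1 (nf Γ w)).1)
    simp only [nf_cons, lmul, List.length_append, length_syl, List.length_cons]
    omega

lemma len_eval_eq (w : List (Syllable G)) : len (eval Γ G w) = (nf Γ w).length := by
  rw [← eval_nf, (red_nf w).len_eval]

lemma len_eval_le (w : List (Syllable G)) : len (eval Γ G w) ≤ w.length := by
  rw [len_eval_eq]; exact length_nf_le w

/-- Each letter contributes at most one syllable to `nf`, so if no length is lost then no letter is
trivial or absorbed. Reducedness can thus be tested by counting. -/
lemma red_and_nf_eq_of_length_le {w : List (Syllable G)} (h : w.length ≤ (nf Γ w).length) :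
    Red Γ w ∧ nf Γ w = w := by
  induction w with
  | nil => exact ⟨trivial, rfl⟩
  | cons s w ih =>
    have h₁ := (red_nf (Γ := Γ) w).length_splitHead_add s.1
    have h₂ := length_nf_le (Γ := Γ) w
    have h₃ := wt_le (s.2 * (splitHead Γ s.1 (nf Γ w)).1)
    simp only [nf_cons, lmul, List.length_append, length_syl, List.length_cons] at h
    obtain ⟨hw, e⟩ := ih (by omega)
    have h₄ : wt (splitHead Γ s.1 (nf Γ w)).1 = 0 := by omega
    have h₅ : wt (s.2 * (splitHead Γ s.1 (nf Γ w)).1) ≠ 0 := by omega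
    rw [wt_eq_zero] at h₄
    rw [h₄, mul_one, Ne, wt_eq_zero] at h₅
    rw [e] at h₄
    have hr : Red Γ (s :: w) := ⟨h₅, h₄, hw⟩
    exact ⟨hr, by rw [nf_cons, e, hr.lmul_eq_cons]⟩

lemma red_of_length_le {w : List (Syllable G)} (h : w.length ≤ len (eval Γ G w)) : Red Γ w :=
  (red_and_nf_eq_of_length_le (by rwa [← len_eval_eq])).1

/-- The formal inverse of a word. -/
def invWord (w : List (Syllable G)) : List (Syllable G) :=
  (w.map fun s => (⟨s.1, s.2⁻¹⟩ : Syllable G)).reverse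

lemma eval_invWord (w : List (Syllable G)) : eval Γ G (invWord w) = (eval Γ G w)⁻¹ := by
  induction w with
  | nil => simp [invWord]
  | cons s w ih =>
    rw [invWord, List.map_cons, List.reverse_cons, eval_append, ← invWord, ih]
    simp

lemma len_inv (c : GraphProduct Γ G) : len c⁻¹ = len c := by
  have key : ∀ c : GraphProduct Γ G, len c⁻¹ ≤ len c := fun c => by
    obtain ⟨w, hw, rfl⟩ := exists_red c
    rw [← eval_invWord, hw.len_eval]
    exact (len_eval_le _).trans (by simp [invWord])
  exact le_antisymm (key c) (by simpa using key c⁻¹)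

/-- Of two syllables at distinct non-adjacent vertices, the earlier blocks the later from reaching
the front. -/
lemma head_eq_one_of_not_adj {u v : V} (hne : u ≠ v) (h : ¬ Γ.Adj u v) (c : GraphProduct Γ G)
    (hu : head u c ≠ 1) : head v c = 1 := by
  unfold head at hu ⊢
  generalize word c = w at hu ⊢
  induction w with
  | nil => rfl
  | cons t w ih =>
    have h' : ¬ Γ.Adj v u := fun k => h k.symm
    rcases syllable_cases Γ v t with ⟨g, rfl⟩ | ht | ⟨ht, ht'⟩
    · simp [splitHead_cons_not_adj (s := ⟨v, g⟩) hne.symm h] at hu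
    · rcases syllable_cases Γ u t with ⟨g, rfl⟩ | hs | ⟨hs, hs'⟩
      · exact absurd ht h'
      · simp only [splitHead_cons_adj ht, splitHead_cons_adj hs] at hu ⊢; exact ih hu
      · simp [splitHead_cons_not_adj hs hs'] at hu
    · simp [splitHead_cons_not_adj ht ht']

variable (Γ G) in
/-- The subgroup generated by a vertex-group and the adjacent ones. -/
def star (u : V) : Subgroup (GraphProduct Γ G) :=
  Subgroup.closure {c | ∃ (v : V) (g : G v), (v = u ∨ Γ.Adj u v) ∧ c = of Γ G v g}

lemma of_mem_star {u v : V} (h : v = u ∨ Γ.Adj u v) (g : G v) : of Γ G v g ∈ star Γ G u :=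
  Subgroup.subset_closure ⟨v, g, h, rfl⟩

lemma eval_mem_star {u : V} {w : List (Syllable G)} (h : ∀ s ∈ w, s.1 = u ∨ Γ.Adj u s.1) :
    eval Γ G w ∈ star Γ G u := by
  induction w with
  | nil => exact one_mem _
  | cons s w ih =>
    rw [eval_cons]
    exact mul_mem (of_mem_star (h s (by simp)) _) (ih fun s hs => h s (by simp [hs]))

lemma splitHead_append_singleton {u v : V} (t : G v) {w : List (Syllable G)}
    (h : v ≠ u ∨ ∃ s ∈ w, ¬ Γ.Adj u s.1) :
    (splitHead Γ u (w ++ [⟨v, t⟩])).1 = (splitHead Γ u w).1 := by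
  induction w with
  | nil =>
    have hv : v ≠ u := by simpa using h
    rcases syllable_cases Γ u (⟨v, t⟩ : Syllable G) with ⟨g, hg⟩ | hs | ⟨hs, hs'⟩
    · exact absurd (congrArg Sigma.fst hg) hv
    · simp [splitHead_cons_adj hs]
    · simp [splitHead_cons_not_adj hs hs']
  | cons s w ih =>
    rcases syllable_cases Γ u s with ⟨g, rfl⟩ | hs | ⟨hs, hs'⟩
    · simp
    · simp only [List.cons_append, splitHead_cons_adj hs]
      exact ih (h.imp_right fun ⟨t, ht, ht'⟩ =>
        ⟨t, (List.mem_cons.1 ht).resolve_left fun e => ht' (e ▸ hs), ht'⟩)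
    · simp [splitHead_cons_not_adj hs hs']

lemma len_mul_of_add {u : V} (g : G u) (c : GraphProduct Γ G) :
    len (c * of Γ G u g) + wt (head u c⁻¹) = len c + wt (g⁻¹ * head u c⁻¹) := by
  have := len_of_mul_add g⁻¹ c⁻¹
  rwa [map_inv, ← mul_inv_rev, len_inv, len_inv] at this

/-- A right factor can affect the head at `u` only by reaching the front itself, which requires `v =
u` and everything before it to lie in the star of `u`. -/
lemma head_mul_of {u v : V} (t : G v) (c : GraphProduct Γ G)
    (hc : v ≠ u ∨ c ∉ star Γ G u) : head u (c * of Γ G v t) = head u c := by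
  have key : ∀ (c : GraphProduct Γ G) (t : G v), (v ≠ u ∨ c ∉ star Γ G u) → head v c⁻¹ = 1 →
      head u (c * of Γ G v t) = head u c := by
    intro c t hc h₁
    rcases eq_or_ne t 1 with rfl | ht
    · simp
    obtain ⟨w, hw, rfl⟩ := exists_red c
    have hl := len_mul_of_add t (eval Γ G w)
    rw [h₁, mul_one, wt_one, wt_of_ne (inv_ne_one.2 ht), hw.len_eval] at hl
    have e : eval Γ G w * of Γ G v t = eval Γ G (w ++ [⟨v, t⟩]) := by simp
    rw [e] at hl ⊢
    rw [(red_of_length_le (by rw [List.length_append, List.length_singleton]; omega) :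
      Red Γ (w ++ [⟨v, t⟩])).head_eval, hw.head_eval]
    refine splitHead_append_singleton t (hc.imp_right fun hc => ?_)
    by_contra! hn
    exact hc (eval_mem_star fun s hs => Or.inr (hn s hs))
  -- Since `c * k` has no syllable at `v` at its right end, the cancellation-free case applies to
  -- both `c * t = (c * k) * (k⁻¹ * t)` and `c = (c * k) * k⁻¹`.
  set k := head v c⁻¹ with hk
  have h₁ : head v (c * of Γ G v k)⁻¹ = 1 := by
    rw [mul_inv_rev, ← map_inv, head_of_mul]; simp [hk]
  have hc' : v ≠ u ∨ c * of Γ G v k ∉ star Γ G u := by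
    by_cases h : v = u
    · refine hc.imp_right fun hc => ?_
      rwa [Subgroup.mul_mem_cancel_right _ (of_mem_star (Or.inl h) k)]
    · exact Or.inl h
  have e₁ := key _ (k⁻¹ * t) hc' h₁
  have e₂ := key _ k⁻¹ hc' h₁
  rw [mul_assoc, ← map_mul] at e₁ e₂
  rw [mul_inv_cancel_left] at e₁
  rw [mul_inv_cancel, map_one, mul_one] at e₂
  rw [e₁, e₂]

/-- In the star, `G u` commutes with all the other generators, so its letters can be collected on
the left. -/
lemma exists_of_mem_star {u : V} {c : GraphProduct Γ G} (h : c ∈ star Γ G u) :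
    ∃ (g : G u) (w : List (Syllable G)), Red Γ w ∧ (∀ s ∈ w, Γ.Adj u s.1) ∧
      c = of Γ G u g * eval Γ G w := by
  suffices ∃ (g : G u) (w : List (Syllable G)), (∀ s ∈ w, Γ.Adj u s.1) ∧
      c = of Γ G u g * eval Γ G w by
    obtain ⟨g, w, hw, rfl⟩ := this
    exact ⟨g, nf Γ w, red_nf w, nf_support hw, by rw [eval_nf]⟩
  have step : ∀ (v : V) (t : G v) (y : GraphProduct Γ G), (v = u ∨ Γ.Adj u v) →
      (∃ (g : G u) (w : List (Syllable G)), (∀ s ∈ w, Γ.Adj u s.1) ∧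
        y = of Γ G u g * eval Γ G w) →
      ∃ (g : G u) (w : List (Syllable G)), (∀ s ∈ w, Γ.Adj u s.1) ∧
        of Γ G v t * y = of Γ G u g * eval Γ G w := by
    rintro v t y hv ⟨g, w, hw, rfl⟩
    rcases hv with rfl | hv
    · exact ⟨t * g, w, hw, by simp [mul_assoc]⟩
    · refine ⟨g, ⟨v, t⟩ :: w, fun s hs => ?_, ?_⟩
      · rcases List.mem_cons.1 hs with rfl | hs
        · exact hv
        · exact hw s hs
      · rw [eval_cons, ← mul_assoc, ← mul_assoc, (commute_of hv g t).eq]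
  induction h using Subgroup.closure_induction_left with
  | one => exact ⟨1, [], by simp, by simp⟩
  | mul_left x hx y _ ih =>
    obtain ⟨v, t, hv, rfl⟩ := hx
    exact step v t y hv ih
  | inv_mul_cancel x hx y _ ih =>
    obtain ⟨v, t, hv, rfl⟩ := hx
    rw [← map_inv]
    exact step v t⁻¹ y hv ih

lemma splitHead_eq_one_of_adj {u : V} {w : List (Syllable G)} (h : ∀ s ∈ w, Γ.Adj u s.1) :
    (splitHead Γ u w).1 = 1 := by
  induction w with
  | nil => rfl
  | cons s w ih =>
    rw [splitHead_cons_adj (h s (by simp))]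
    exact ih fun s hs => h s (by simp [hs])

lemma commute_eval {u : V} (g : G u) {w : List (Syllable G)} (h : ∀ s ∈ w, Γ.Adj u s.1) :
    Commute (of Γ G u g) (eval Γ G w) := by
  induction w with
  | nil => exact Commute.one_right _
  | cons s w ih =>
    rw [eval_cons]
    exact (commute_of (h s (by simp)) _ _).mul_right (ih fun s hs => h s (by simp [hs]))

/-- Conjugation by an element of a vertex-group. -/
def conj {u : V} (s : G u) (c : GraphProduct Γ G) : GraphProduct Γ G :=
  of Γ G u s * c * (of Γ G u s)⁻¹

lemma conj_conj {u : V} (s t : G u) (c : GraphProduct Γ G) :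
    conj s (conj t c) = conj (s * t) c := by simp [conj, mul_assoc]

@[simp] lemma conj_one (u : V) (c : GraphProduct Γ G) : conj (1 : G u) c = c := by simp [conj]

lemma conj_inv {u : V} (s : G u) (c : GraphProduct Γ G) : (conj s c)⁻¹ = conj s c⁻¹ := by
  simp [conj, mul_assoc]

lemma conj_eq {u : V} (s : G u) (c : GraphProduct Γ G) :
    conj s c = of Γ G u s * (c * of Γ G u s⁻¹) := by
  simp [conj, mul_assoc]

lemma conj_of_mul_eval {u : V} (s g : G u) {w : List (Syllable G)}
    (h : ∀ s ∈ w, Γ.Adj u s.1) :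
    conj s (of Γ G u g * eval Γ G w) = of Γ G u (s * g * s⁻¹) * eval Γ G w := by
  rw [conj_eq, mul_assoc (of Γ G u g), ← (commute_eval s⁻¹ h).eq]
  simp [mul_assoc]

lemma len_conj_of_mem_star {u : V} (s : G u) {c : GraphProduct Γ G} (h : c ∈ star Γ G u) :
    len (conj s c) = len c := by
  obtain ⟨g, w, hw, ha, rfl⟩ := exists_of_mem_star h
  rw [conj_of_mul_eval s g ha]
  have h₁ := len_of_mul_add g (eval Γ G w)
  have h₂ := len_of_mul_add (s * g * s⁻¹) (eval Γ G w)
  rw [hw.head_eval, splitHead_eq_one_of_adj ha, mul_one] at h₁ h₂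
  have : wt (s * g * s⁻¹) = wt g := by
    rcases eq_or_ne g 1 with rfl | hg
    · simp
    · rw [wt_of_ne hg, wt_of_ne (mt conj_eq_one_iff.1 hg)]
  omega

lemma len_conj_add {u : V} (s : G u) {c : GraphProduct Γ G} (h : c ∉ star Γ G u) :
    len (conj s c) + (wt (head u c) + wt (head u c⁻¹)) =
      len c + (wt (s * head u c) + wt (s * head u c⁻¹)) := by
  have h₁ := len_of_mul_add s c
  have h₂ := len_mul_of_add s⁻¹ (of Γ G u s * c)
  rw [mul_inv_rev, ← map_inv, head_mul_of s⁻¹ c⁻¹ (Or.inr (by simpa using h)), mul_assoc,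
    ← conj_eq, inv_inv] at h₂
  omega

lemma head_conj {u v : V} (h : Γ.Adj u v) (t : G v) (c : GraphProduct Γ G) :
    head u (conj t c) = head u c := by
  rw [conj_eq, head_of_mul_adj h, head_mul_of _ _ (Or.inl h.ne')]

lemma conj_mem_star {u v : V} (h : Γ.Adj u v) (t : G v) (c : GraphProduct Γ G) :
    conj t c ∈ star Γ G u ↔ c ∈ star Γ G u := by
  rw [conj_eq, Subgroup.mul_mem_cancel_left _ (of_mem_star (Or.inr h) t),
    Subgroup.mul_mem_cancel_right _ (of_mem_star (Or.inr h) _)]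

lemma conj_comm {u v : V} (h : Γ.Adj u v) (s : G u) (t : G v) (c : GraphProduct Γ G) :
    conj s (conj t c) = conj t (conj s c) := by
  unfold conj
  have := (commute_of h s t).eq
  calc _ = (of Γ G u s * of Γ G v t) * c * (of Γ G u s * of Γ G v t)⁻¹ := by group
    _ = _ := by rw [this]; group

/-- If one end were trivial, conjugation would create a syllable there, and the other end can lose
at most one. -/
lemma head_ne_one_of_len_conj_lt {u : V} {s : G u} {c : GraphProduct Γ G}
    (h : len (conj s c) < len c) : c ∉ star Γ G u ∧ head u c ≠ 1 ∧ head u c⁻¹ ≠ 1 := by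
  have hs : c ∉ star Γ G u := fun k => by simp [len_conj_of_mem_star s k] at h
  have e := len_conj_add s hs
  have hw : wt s = 1 := wt_of_ne fun hs => by simp [hs] at h
  refine ⟨hs, fun k => ?_, fun k => ?_⟩
  · have := wt_le (head u c⁻¹)
    rw [k, wt_one, mul_one] at e; omega
  · have := wt_le (head u c)
    rw [k, wt_one, mul_one] at e; omega

/-- Local confluence of length-reducing conjugations by elements of vertex-groups. -/
lemma conj_confluent {u v : V} (s : G u) (t : G v) (c : GraphProduct Γ G)
    (h₁ : len (conj s c) < len c) (h₂ : len (conj t c) ≤ len c) :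
    (∃ (w : V) (k : G w), conj t c = conj k (conj s c)) ∨
      conj t (conj s c) = conj s (conj t c) ∧ len (conj s (conj t c)) < len (conj t c) := by
  by_cases huv : u = v
  · subst huv
    exact Or.inl ⟨u, t * s⁻¹, by simp [conj_conj]⟩
  obtain ⟨hs, h₃, h₄⟩ := head_ne_one_of_len_conj_lt h₁
  have e := len_conj_add s hs
  by_cases hadj : Γ.Adj u v
  -- Conjugating by `t` changes neither the ends at `u` nor membership in the star of `u`, so `s`
  -- shortens `conj t c` by as much as it shortens `c`.
  · refine Or.inr ⟨(conj_comm hadj s t c).symm, ?_⟩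
    have e' := len_conj_add s (mt (conj_mem_star hadj t c).1 hs)
    rw [conj_inv, head_conj hadj, head_conj hadj] at e'
    omega
  · rcases eq_or_ne t 1 with rfl | ht
    · exact Or.inl ⟨u, s⁻¹, by simp [conj_conj]⟩
    -- The nontrivial ends at `u` block both ends at `v`, so conjugation by `t ≠ 1` adds two
    -- syllables, against `h₂`.
    exfalso
    have h₅ := head_eq_one_of_not_adj huv hadj c h₃
    have h₆ : head v (c⁻¹ * of Γ G v t⁻¹) = 1 :=
      head_eq_one_of_not_adj huv hadj _ (by rwa [head_mul_of _ _ (Or.inl (Ne.symm huv))])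
    have e₁ := len_of_mul_add t c
    have e₂ := len_mul_of_add t⁻¹ (of Γ G v t * c)
    rw [mul_inv_rev, ← map_inv, h₆, mul_assoc, ← conj_eq, inv_inv, mul_one, wt_one,
      wt_of_ne ht] at e₂
    rw [h₅, mul_one, wt_one, wt_of_ne ht] at e₁
    omega

end Elements

end GraphProduct

/-! ### Peak reduction in an abstract graph with a length function -/

/-- An element is locally minimal if its neighbours are at least as long. -/
def IsLocMin {X : Type*} (E : X → X → Prop) (len : X → ℕ) (a : X) : Prop :=
  ∀ c, E a c → len a ≤ len c

/-- A step between two locally minimal elements of the same length. -/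
def LevelStep {X : Type*} (E : X → X → Prop) (len : X → ℕ) (x y : X) : Prop :=
  E x y ∧ len x = len y ∧ IsLocMin E len x ∧ IsLocMin E len y

/-- Peak reduction: if the two ends of a peak can be joined below it, then connected locally minimal
elements are connected through locally minimal elements of the same length. -/
theorem reflTransGen_levelStep {X : Type*} {E : X → X → Prop} {len : X → ℕ}
    (symm : ∀ {x y}, E x y → E y x)
    (conf : ∀ {c c₁ c₂}, E c c₁ → E c c₂ → len c₁ < len c → len c₂ ≤ len c →
      E c₁ c₂ ∨ ∃ d, E c₁ d ∧ E d c₂ ∧ len d < len c₂)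
    {a b : X} (ha : IsLocMin E len a) (hb : IsLocMin E len b)
    (h : Relation.ReflTransGen E a b) :
    Relation.ReflTransGen (LevelStep E len) a b := by
  let Down : X → X → Prop := Relation.ReflTransGen fun x y => E x y ∧ len y ≤ len x
  let Level : X → X → Prop := Relation.ReflTransGen (LevelStep E len)
  have level_symm : ∀ {x y}, Level x y → Level y x := fun h => by
    induction h with
    | refl => exact .refl
    | tail _ h ih => exact .head ⟨symm h.1, h.2.1.symm, h.2.2.2, h.2.2.1⟩ ih
  have level_down : ∀ {x y}, Level x y → Down x y := fun h =>
    Relation.ReflTransGen.mono (fun x y h => ⟨h.1, h.2.1.ge⟩) _ _ h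
  have exists_min : ∀ n c, len c = n → ∃ a, IsLocMin E len a ∧ Down c a := by
    intro n
    induction n using Nat.strong_induction_on with
    | _ n ih =>
      intro c hc
      by_cases hm : IsLocMin E len c
      · exact ⟨c, hm, .refl⟩
      · unfold IsLocMin at hm
        push Not at hm
        obtain ⟨c₁, h₁, h₂⟩ := hm
        obtain ⟨a, ha, hd⟩ := ih _ (hc ▸ h₂) c₁ rfl
        exact ⟨a, ha, .head ⟨h₁, h₂.le⟩ hd⟩
  -- Reachability of a minimum by descent transfers across an edge. If `y` is not longer than `x`,
  -- any minimum `b` below `y` is also below `x`, hence level-connected to `a` by uniqueness at `x`.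
  have step : ∀ {x y a}, (∀ a b, IsLocMin E len a → IsLocMin E len b → Down x a → Down x b →
      Level a b) → (∀ a b, IsLocMin E len a → IsLocMin E len b → Down y a → Down y b →
      Level a b) → E x y → IsLocMin E len a → Down x a → Down y a := by
    intro x y a hx hy h ha hd
    rcases le_total (len x) (len y) with hl | hl
    · exact .head ⟨symm h, hl⟩ hd
    · obtain ⟨b, hb, hb'⟩ := exists_min _ y rfl
      exact hb'.trans (level_down (hx b a hb ha (.head ⟨h, hl⟩ hb') hd))
  have uniq : ∀ n c, len c = n → ∀ a b, IsLocMin E len a → IsLocMin E len b →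
      Down c a → Down c b → Level a b := by
    intro n
    induction n using Nat.strong_induction_on with
    | _ n ih =>
      intro c hc
      by_cases hm : IsLocMin E len c
      -- A descent from a local minimum stays level: a drop from `y` to `z` after a level step from
      -- `x` to `y` would, by `conf`, give `x` a shorter neighbour.
      · have key : ∀ a, Down c a → Level c a ∧ IsLocMin E len a := by
          intro a h
          induction h with
          | refl => exact ⟨.refl, hm⟩
          | @tail x y _ hxy ih =>
            obtain ⟨hl, hx⟩ := ih
            have e : len x = len y := le_antisymm (hx y hxy.1) hxy.2
            have hy : IsLocMin E len y := by
              intro z hz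
              by_contra! hlt
              rcases conf hz (symm hxy.1) hlt e.le with h | ⟨d, -, h, h'⟩
              · have := hx z (symm h); omega
              · have := hx d (symm h); omega
            exact ⟨hl.tail ⟨hxy.1, e, hx, hy⟩, hy⟩
        intro a b _ _ h h'
        exact (level_symm (key a h).1).trans (key b h').1
      · unfold IsLocMin at hm
        push Not at hm
        obtain ⟨c₁, h₁, h₂⟩ := hm
        -- Any descent from `c` can be rerouted through a strictly shorter neighbour `c₁`. The
        -- induction along the descent lets `c₁` vary, since each level step replaces it by a
        -- shorter neighbour of the next element.
        have key : ∀ a, IsLocMin E len a → Down c a → Down c₁ a := by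
          intro a ha hd
          induction hd using Relation.ReflTransGen.head_induction_on generalizing c₁ with
          | refl => exact absurd (ha c₁ h₁) (by omega)
          | @head x y hxy hd ih' =>
            rcases hxy.2.lt_or_eq with hlt | heq
            · rcases conf h₁ hxy.1 h₂ hxy.2 with h | ⟨d, h, h', hl⟩
              · exact step (ih _ (hc ▸ hlt) y rfl) (ih _ (hc ▸ h₂) c₁ rfl) (symm h) ha hd
              · have hdn : Down d a := step (ih _ (hc ▸ hlt) y rfl)
                  (ih _ (by omega) d rfl) (symm h') ha hd
                exact step (ih _ (by omega) d rfl) (ih _ (hc ▸ h₂) c₁ rfl) (symm h) ha hdn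
            · rcases conf h₁ hxy.1 h₂ hxy.2 with h | ⟨d, h, h', hl⟩
              · exact ih' (by omega) c₁ (symm h) (by omega)
              · exact step (ih _ (by omega) d rfl) (ih _ (hc ▸ h₂) c₁ rfl) (symm h) ha
                  (ih' (by omega) d (symm h') hl)
        intro a b ha hb h h'
        exact ih _ (hc ▸ h₂) c₁ rfl a b ha hb (key a ha h) (key b hb h')
  -- With uniqueness known at every element, `step` carries descent to `a` along the whole path,
  -- including its ascents. At `b` both `a` and `b` are then reachable minima.
  have hd : ∀ y, Relation.ReflTransGen E a y → Down y a := fun y hy => by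
    induction hy with
    | refl => exact .refl
    | @tail x y _ hxy ih => exact step (uniq _ x rfl) (uniq _ y rfl) hxy ha ih
  exact uniq _ b rfl a b ha hb (hd b h) .refl

namespace GraphProduct

variable {V : Type u} {Γ : SimpleGraph V} {G : V → Type v} [∀ u, Group (G u)]

/-! ### From conjugate elements to moves on words -/

section Conjugacy

variable (Γ G) in
/-- Conjugate by an element of a vertex-group. -/
def ConjStep (a b : GraphProduct Γ G) : Prop := ∃ (u : V) (s : G u), b = conj s a

lemma ConjStep.symm {a b : GraphProduct Γ G} (h : ConjStep Γ G a b) : ConjStep Γ G b a := by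
  obtain ⟨u, s, rfl⟩ := h
  exact ⟨u, s⁻¹, by simp [conj_conj]⟩

lemma reflTransGen_conjStep {a b : GraphProduct Γ G} (h : IsConj a b) :
    Relation.ReflTransGen (ConjStep Γ G) a b := by
  obtain ⟨c, rfl⟩ := isConj_iff.1 h
  obtain ⟨w, rfl⟩ := exists_eval c
  clear h
  induction w with
  | nil => simpa using Relation.ReflTransGen.refl
  | cons s w ih => exact ih.tail ⟨s.1, s.2, by simp [conj, mul_assoc]⟩

lemma IsConj.reflTransGen_levelStep {a b : GraphProduct Γ G} (h : IsConj a b)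
    (ha : IsLocMin (ConjStep Γ G) len a) (hb : IsLocMin (ConjStep Γ G) len b) :
    Relation.ReflTransGen (LevelStep (ConjStep Γ G) len) a b := by
  refine _root_.reflTransGen_levelStep ConjStep.symm ?_ ha hb (reflTransGen_conjStep h)
  rintro c _ _ ⟨u, s, rfl⟩ ⟨v, t, rfl⟩ h₁ h₂
  rcases conj_confluent s t c h₁ h₂ with h | ⟨h, h'⟩
  · exact Or.inl h
  · exact Or.inr ⟨conj s (conj t c), ⟨v, t, h.symm⟩, ConjStep.symm ⟨u, s, rfl⟩, h'⟩

lemma splitHead_ne_one {u : V} {w : List (Syllable G)} (hw : Red Γ w) {j : ℕ} (hj : j < w.length)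
    (hu : w[j].1 = u) (h : ∀ (k : ℕ) (hk : k < j), Γ.Adj u w[k].1) :
    (splitHead Γ u w).1 ≠ 1 := by
  induction w generalizing j with
  | nil => simp at hj
  | cons s w ih =>
    cases j with
    | zero =>
      obtain ⟨v, g⟩ := s
      obtain rfl : v = u := hu
      simpa using hw.1
    | succ j =>
      rw [splitHead_cons_adj (s := s) (h 0 (by omega))]
      exact ih hw.2.2 (Nat.lt_of_succ_lt_succ hj) hu fun k hk => h (k + 1) (by omega)

/-- If nothing separates two syllables of one vertex-group, the later one is a nontrivial head of
the word following the earlier one. -/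
lemma Red.isGraphicallyReduced {w : List (Syllable G)} (hw : Red Γ w) :
    IsGraphicallyReduced Γ G w := by
  constructor
  · right
    induction w with
    | nil => simp
    | cons s w ih => exact List.forall_mem_cons.2 ⟨hw.1, ih hw.2.2⟩
  · induction w with
    | nil => intro i j hij hj; simp at hj
    | cons s w ih =>
      rintro i j hij hj e
      obtain ⟨j, rfl⟩ : ∃ j', j = j' + 1 := ⟨j - 1, by omega⟩
      cases i with
      | succ i =>
        obtain ⟨k, h₁, h₂, h₃⟩ := ih hw.2.2 i j (by omega) (Nat.lt_of_succ_lt_succ hj) e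
        exact ⟨k + 1, by omega, by omega, h₃⟩
      | zero =>
        by_contra! hn
        refine splitHead_ne_one hw.2.2 (Nat.lt_of_succ_lt_succ hj) e.symm (fun k hk => ?_) hw.2.1
        exact (hn (k + 1) (by omega) (by omega)).symm

lemma red_of_eval_eq {w : List (Syllable G)} {c : GraphProduct Γ G} (e : eval Γ G w = c)
    (h : w.length ≤ len c) : Red Γ w :=
  red_of_length_le (e ▸ h)

lemma IsGraphicallyCyclicallyReducedElement.isLocMin {a : GraphProduct Γ G}
    (ha : IsGraphicallyCyclicallyReducedElement Γ G a) : IsLocMin (ConjStep Γ G) len a := by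
  rintro _ ⟨u, s, rfl⟩
  by_contra! hlt
  obtain ⟨hs, h₁, h₂⟩ := head_ne_one_of_len_conj_lt hlt
  set h := head u a
  set k := head u a⁻¹
  have e₁ := len_of_mul_add h⁻¹ a
  rw [inv_mul_cancel, wt_one, wt_of_ne h₁] at e₁
  have e₂ := len_mul_of_add k (of Γ G u h⁻¹ * a)
  rw [mul_inv_rev, ← map_inv, head_mul_of _ _ (Or.inr (by simpa using hs)), inv_mul_cancel, wt_one,
    wt_of_ne h₂] at e₂
  set m := of Γ G u h⁻¹ * a * of Γ G u k with hm
  -- Both ends at `u` are nontrivial and were stripped off independently, so by the length count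
  -- this word is reduced. Its first and last syllables contradict cyclic reducedness.
  have e : eval Γ G (⟨u, h⟩ :: (word m ++ [⟨u, k⁻¹⟩])) = a := by simp [hm, mul_assoc]
  have hr : Red Γ (⟨u, h⟩ :: (word m ++ [⟨u, k⁻¹⟩])) := red_of_eval_eq e <| by
    have : (word m).length = len m := rfl
    simp only [List.length_cons, List.length_append, List.length_nil]; omega
  refine (ha _ hr.isGraphicallyReduced e).2 ⟨0, (word m).length + 1, by omega, by simp, ?_, ?_, ?_⟩
  · simp
  · intro k hk; omega
  · intro k hk hk'; simp at hk'; omega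

/-- The moves on words realizing conjugations between cyclically reduced elements. -/
inductive WordMove (Γ : SimpleGraph V) : List (Syllable G) → List (Syllable G) → Prop
  | cyclic {w w' : List (Syllable G)} (h : CyclicMove Γ G w w') : WordMove Γ w w'
  | conj {u : V} (g k : G u) (w : List (Syllable G)) (h : ∀ s ∈ w, Γ.Adj u s.1) :
      WordMove Γ (⟨u, g⟩ :: w) (⟨u, k * g * k⁻¹⟩ :: w)

lemma CyclicallyRelated.wordMove {w w' : List (Syllable G)} (h : CyclicallyRelated Γ G w w') :
    Relation.ReflTransGen (WordMove Γ) w w' :=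
  Relation.ReflTransGen.mono (fun _ _ h => .cyclic h) _ _ h

lemma Red.wordMove_word {w : List (Syllable G)} (h : Red Γ w) {c : GraphProduct Γ G}
    (e : eval Γ G w = c) : Relation.ReflTransGen (WordMove Γ) w (word c) :=
  (h.shuffle_word e).cyclicallyRelated.wordMove

lemma Red.word_wordMove {w : List (Syllable G)} (h : Red Γ w) {c : GraphProduct Γ G}
    (e : eval Γ G w = c) : Relation.ReflTransGen (WordMove Γ) (word c) w :=
  (h.shuffle_word e).symm.cyclicallyRelated.wordMove

/-- In the star, the conjugation acts on one floating syllable. Outside it, constancy of length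
forces a syllable to cancel at one end while it is created at the other, which is a rotation. -/
lemma LevelStep.wordMove {a b : GraphProduct Γ G} (h : LevelStep (ConjStep Γ G) len a b) :
    Relation.ReflTransGen (WordMove Γ) (word a) (word b) := by
  obtain ⟨⟨u, s, rfl⟩, hl, ha, -⟩ := h
  rcases eq_or_ne s 1 with rfl | hs
  · rw [conj_one]
  by_cases hstar : a ∈ star Γ G u
  · obtain ⟨g, w, hw, hadj, rfl⟩ := exists_of_mem_star hstar
    rw [conj_of_mul_eval s g hadj]
    have hr : ∀ g : G u, g ≠ 1 → Red Γ (⟨u, g⟩ :: w) := fun g hg =>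
      ⟨hg, splitHead_eq_one_of_adj hadj, hw⟩
    rcases eq_or_ne g 1 with rfl | hg
    · simp only [mul_one, mul_inv_cancel]; exact .refl
    · exact ((hr g hg).word_wordMove (by simp)).trans (.head (.conj g s w hadj)
        ((hr _ (mt conj_eq_one_iff.1 hg)).wordMove_word (by simp)))
  · have e := len_conj_add s hstar
    -- Conjugating by the inverse of the head kills the left end, so minimality of `a` shows that
    -- the two ends at `u` cannot both be nontrivial.
    have e₁ := len_conj_add (head u a)⁻¹ hstar
    have hmin := ha _ ⟨u, (head u a)⁻¹, rfl⟩
    have hw₁ := wt_le ((head u a)⁻¹ * head u a⁻¹)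
    rw [inv_mul_cancel, wt_one] at e₁
    by_cases h₁ : head u a = 1
    · have h₂ : s * head u a⁻¹ = 1 := by
        rw [h₁, mul_one, wt_one, wt_of_ne hs] at e
        have := wt_le (head u a⁻¹)
        rw [← wt_eq_zero]; omega
      have hk : head u a⁻¹ = s⁻¹ := eq_inv_of_mul_eq_one_right h₂
      have e₂ := len_mul_of_add s⁻¹ a
      rw [hk, inv_inv, mul_inv_cancel, wt_one, wt_of_ne (inv_ne_one.2 hs)] at e₂
      have hlen : (word (a * of Γ G u s⁻¹)).length = len (a * of Γ G u s⁻¹) := rfl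
      have ea : eval Γ G (word (a * of Γ G u s⁻¹) ++ [⟨u, s⟩]) = a := by simp
      have eb : eval Γ G ([⟨u, s⟩] ++ word (a * of Γ G u s⁻¹)) = conj s a := by
        simp [conj, mul_assoc]
      have ra := red_of_eval_eq ea (by simp only [List.length_append, List.length_singleton]; omega)
      have rb := red_of_eval_eq eb (by simp only [List.length_append, List.length_singleton]; omega)
      exact (ra.word_wordMove ea).trans (.head (.cyclic (.rotate _ _)) (rb.wordMove_word eb))
    · have h₂ : head u a⁻¹ = 1 := by
        rw [wt_of_ne h₁] at e₁
        rw [← wt_eq_zero]; omega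
      have h₃ : s * head u a = 1 := by
        rw [h₂, mul_one, wt_one, wt_of_ne hs, wt_of_ne h₁] at e
        rw [← wt_eq_zero]; omega
      have hk : head u a = s⁻¹ := eq_inv_of_mul_eq_one_right h₃
      have e₂ := len_of_mul_add s a
      rw [hk, mul_inv_cancel, wt_one, wt_of_ne (inv_ne_one.2 hs)] at e₂
      have hlen : (word (of Γ G u s * a)).length = len (of Γ G u s * a) := rfl
      have ea : eval Γ G ([⟨u, s⁻¹⟩] ++ word (of Γ G u s * a)) = a := by simp
      have eb : eval Γ G (word (of Γ G u s * a) ++ [⟨u, s⁻¹⟩]) = conj s a := by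
        simp [conj, mul_assoc]
      have ra := red_of_eval_eq ea (by simp only [List.length_append, List.length_singleton]; omega)
      have rb := red_of_eval_eq eb (by simp only [List.length_append, List.length_singleton]; omega)
      exact (ra.word_wordMove ea).trans (.head (.cyclic (.rotate _ _)) (rb.wordMove_word eb))

lemma IsConj.wordMove {a b : GraphProduct Γ G} (h : IsConj a b)
    (ha : IsLocMin (ConjStep Γ G) len a) (hb : IsLocMin (ConjStep Γ G) len b) :
    Relation.ReflTransGen (WordMove Γ) (word a) (word b) := by
  have := IsConj.reflTransGen_levelStep h ha hb
  clear h
  induction this with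
  | refl => exact .refl
  | tail _ h ih => exact (ih h.2.2.1).trans (LevelStep.wordMove h)

end Conjugacy

/-! ### Separating the floating syllables from the rest -/

section Floating

/-- The multiset of the vertices of the syllables of a word. -/
def vertices (w : List (Syllable G)) : Multiset V := ((w.map Sigma.fst : List V) : Multiset V)

variable (Γ) in
/-- `v` belongs to the multiset `M` and is adjacent to all other members. -/
def FloatsIn (M : Multiset V) (v : V) : Prop := ∃ N, M = v ::ₘ N ∧ ∀ x ∈ N, Γ.Adj v x

open Classical in
/-- The syllables whose vertices satisfy `φ`. -/
noncomputable def restrict (φ : V → Prop) (w : List (Syllable G)) : List (Syllable G) :=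
  w.filter fun s => decide (φ s.1)

@[simp] lemma restrict_append (φ : V → Prop) (w w' : List (Syllable G)) :
    restrict φ (w ++ w') = restrict φ w ++ restrict φ w' := by simp [restrict]

lemma restrict_cons_of_pos {φ : V → Prop} {s : Syllable G} (h : φ s.1) (w : List (Syllable G)) :
    restrict φ (s :: w) = s :: restrict φ w := by simp [restrict, h]

lemma restrict_cons_of_neg {φ : V → Prop} {s : Syllable G} (h : ¬ φ s.1) (w : List (Syllable G)) :
    restrict φ (s :: w) = restrict φ w := by simp [restrict, h]

lemma mem_restrict {φ : V → Prop} {w : List (Syllable G)} {s : Syllable G} :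
    s ∈ restrict φ w ↔ s ∈ w ∧ φ s.1 := by simp [restrict]

lemma restrict_perm (φ : V → Prop) {w w' : List (Syllable G)} (h : w.Perm w') :
    (restrict φ w).Perm (restrict φ w') := h.filter _

lemma CyclicMove.perm {w w' : List (Syllable G)} (h : CyclicMove Γ G w w') : w.Perm w' := by
  cases h with
  | swap l l' s t h => exact (List.Perm.swap _ _ _).append_left l
  | rotate l l' => exact List.perm_append_comm

lemma CyclicallyRelated.perm {w w' : List (Syllable G)} (h : CyclicallyRelated Γ G w w') :
    w.Perm w' := by
  induction h with
  | refl => exact .refl _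
  | tail _ h ih => exact ih.trans h.perm

/-- Deleting syllables turns a rotation into a rotation, and a swap into a swap or into no move at
all. -/
lemma CyclicMove.restrict (φ : V → Prop) {w w' : List (Syllable G)} (h : CyclicMove Γ G w w') :
    CyclicallyRelated Γ G (restrict φ w) (restrict φ w') := by
  cases h with
  | swap l l' s t h =>
    by_cases hs : φ s.1 <;> by_cases ht : φ t.1 <;>
      simp only [restrict_append, restrict_cons_of_pos, restrict_cons_of_neg, hs, ht,
        not_false_eq_true]
    · exact .single (.swap _ _ _ _ h)
    all_goals exact .refl
  | rotate l l' =>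
    rw [restrict_append, restrict_append]
    exact .single (.rotate _ _)

/-- The vertex of a syllable together with its conjugacy class. -/
def syllableClass (s : Syllable G) : Σ u : V, ConjClasses (G u) := ⟨s.1, ConjClasses.mk s.2⟩

lemma conjInVertexGroup_of_eq {s t : Syllable G} (h : syllableClass s = syllableClass t) :
    ConjInVertexGroup G s t := by
  obtain ⟨u, g⟩ := s
  obtain ⟨v, k⟩ := t
  obtain rfl : u = v := congrArg Sigma.fst h
  exact ⟨u, g, k, rfl, rfl, ConjClasses.mk_eq_mk_iff_isConj.1 (eq_of_heq (Sigma.mk.inj h).2)⟩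

lemma vertices_eq_of_perm {w w' : List (Syllable G)} (h : w.Perm w') :
    vertices w = vertices w' := Multiset.coe_eq_coe.2 (h.map _)

lemma WordMove.vertices {w w' : List (Syllable G)} (h : WordMove Γ w w') :
    vertices w = GraphProduct.vertices w' := by
  cases h with
  | cyclic h => exact vertices_eq_of_perm h.perm
  | conj g k w h => rfl

/-- A conjugation move touches only a floating syllable, so it is invisible outside the floating
part and preserves conjugacy classes inside it. Testing `FloatsIn` on the vertices of `w` alone
keeps the predicate fixed along a chain of moves. -/
lemma WordMove.restrict {w w' : List (Syllable G)} (h : WordMove Γ w w') :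
    CyclicallyRelated Γ G (restrict (fun v => ¬ FloatsIn Γ (GraphProduct.vertices w) v) w)
        (GraphProduct.restrict (fun v => ¬ FloatsIn Γ (GraphProduct.vertices w) v) w') ∧
      ((GraphProduct.restrict (FloatsIn Γ (GraphProduct.vertices w)) w).map syllableClass).Perm
        ((GraphProduct.restrict (FloatsIn Γ (GraphProduct.vertices w)) w').map syllableClass) := by
  cases h with
  | cyclic h => exact ⟨h.restrict _, (restrict_perm _ h.perm).map _⟩
  | @conj u g k w h =>
    have hu : FloatsIn Γ (GraphProduct.vertices (⟨u, g⟩ :: w : List (Syllable G))) u := by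
      refine ⟨GraphProduct.vertices w, rfl, fun x hx => ?_⟩
      obtain ⟨s, hs, rfl⟩ := List.mem_map.1 (Multiset.mem_coe.1 hx)
      exact h s hs
    generalize GraphProduct.vertices (⟨u, g⟩ :: w : List (Syllable G)) = M at hu ⊢
    constructor
    · rw [restrict_cons_of_neg (s := ⟨u, g⟩) (by simpa using hu),
        restrict_cons_of_neg (s := ⟨u, k * g * k⁻¹⟩) (by simpa using hu)]
      exact .refl
    · rw [restrict_cons_of_pos (s := ⟨u, g⟩) hu,
        restrict_cons_of_pos (s := ⟨u, k * g * k⁻¹⟩) hu, List.map_cons, List.map_cons]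
      have : syllableClass (⟨u, g⟩ : Syllable G) = syllableClass ⟨u, k * g * k⁻¹⟩ := by
        unfold syllableClass
        congr 1
        exact ConjClasses.mk_eq_mk_iff_isConj.2 (isConj_iff.2 ⟨k, rfl⟩)
      rw [this]

lemma restrict_of_wordMoves {w w' : List (Syllable G)}
    (h : Relation.ReflTransGen (WordMove Γ) w w') :
    vertices w = vertices w' ∧
    CyclicallyRelated Γ G (restrict (fun v => ¬ FloatsIn Γ (vertices w) v) w)
        (restrict (fun v => ¬ FloatsIn Γ (vertices w) v) w') ∧
      ((restrict (FloatsIn Γ (vertices w)) w).map syllableClass).Perm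
        ((restrict (FloatsIn Γ (vertices w)) w').map syllableClass) := by
  induction h with
  | refl => exact ⟨rfl, .refl, .refl _⟩
  | tail _ h ih =>
    obtain ⟨h₁, h₂, h₃⟩ := ih
    have := h.restrict
    rw [← h₁] at this
    exact ⟨h₁.trans h.vertices, h₂.trans this.1, h₃.trans this.2⟩

variable (Γ) in
/-- If one of the two syllables satisfies `φ` then they are adjacent. -/
def FloatRel (φ : V → Prop) (s t : Syllable G) : Prop := φ s.1 ∨ φ t.1 → Γ.Adj s.1 t.1

lemma FloatRel.symm {φ : V → Prop} {s t : Syllable G} (h : FloatRel Γ φ s t) :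
    FloatRel Γ φ t s := fun k => (h k.symm).symm

/-- Multiplicities matter: two syllables at different positions give a two-element submultiset, even
when their vertices coincide. -/
lemma pairwise_floatRel (w : List (Syllable G)) :
    w.Pairwise (FloatRel Γ (FloatsIn Γ (vertices w))) := by
  rw [List.pairwise_iff_forall_sublist]
  intro s t hst
  have key : ∀ x y : V, (({x, y} : Multiset V) ≤ vertices w) → FloatsIn Γ (vertices w) x →
      Γ.Adj x y := by
    rintro x y hle ⟨N, hN, hadj⟩
    rw [hN] at hle
    exact hadj y (Multiset.singleton_le.1 ((Multiset.cons_le_cons_iff x).1 hle))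
  have hle : (({s.1, t.1} : Multiset V) ≤ vertices w) :=
    Multiset.coe_le.2 (hst.map Sigma.fst).subperm
  rintro (h | h)
  · exact key _ _ hle h
  · exact (key _ _ (by rwa [Multiset.pair_comm]) h).symm

lemma shuffle_cons_append {s : Syllable G} {A : List (Syllable G)} (h : ∀ t ∈ A, Γ.Adj s.1 t.1)
    (B : List (Syllable G)) : Shuffle Γ (s :: (A ++ B)) (A ++ s :: B) := by
  induction A with
  | nil => exact .refl _
  | cons t A ih =>
    exact (Shuffle.swap (h t (by simp)) _).trans (.cons t (ih fun t ht => h t (by simp [ht])))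

lemma shuffle_restrict {φ : V → Prop} {w : List (Syllable G)} (h : w.Pairwise (FloatRel Γ φ)) :
    Shuffle Γ w (restrict (fun v => ¬ φ v) w ++ restrict φ w) := by
  induction w with
  | nil => exact .nil
  | cons s w ih =>
    obtain ⟨h₁, h₂⟩ := List.pairwise_cons.1 h
    by_cases hs : φ s.1
    · rw [restrict_cons_of_neg (by simpa using hs), restrict_cons_of_pos hs]
      exact (Shuffle.cons s (ih h₂)).trans
        (shuffle_cons_append (fun t ht => h₁ t (mem_restrict.1 ht).1 (Or.inl hs)) _)
    · rw [restrict_cons_of_pos (φ := fun v => ¬ φ v) hs, restrict_cons_of_neg hs]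
      exact .cons s (ih h₂)

lemma Shuffle.of_perm {w w' : List (Syllable G)} (h : w.Perm w')
    (hw : w.Pairwise fun s t => Γ.Adj s.1 t.1) : Shuffle Γ w w' := by
  induction h with
  | nil => exact .nil
  | cons s _ ih => exact .cons s (ih (List.pairwise_cons.1 hw).2)
  | swap s t w =>
    exact .swap ((List.pairwise_cons.1 hw).1 s (by simp)) w
  | trans h _ ih₁ ih₂ =>
    exact (ih₁ hw).trans (ih₂ ((h.pairwise_iff fun h => h.symm).1 hw))

/-- A word with a reordering of its floating syllables at the end. -/
lemma floating_normalization {φ : V → Prop} {w q : List (Syllable G)}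
    (h : w.Pairwise (FloatRel Γ φ)) (hq : q.Perm (restrict φ w)) :
    Shuffle Γ w (restrict (fun v => ¬ φ v) w ++ q) ∧
      ∀ i < q.length, IsFloating Γ G (restrict (fun v => ¬ φ v) w ++ q)
        ((restrict (fun v => ¬ φ v) w).length + i) := by
  have h₁ := shuffle_restrict h
  have h₂ : (restrict φ w).Pairwise fun s t => Γ.Adj s.1 t.1 := by
    refine List.Pairwise.imp_of_mem ?_ (List.Pairwise.filter _ h)
    exact fun hs _ hR => hR (Or.inl (mem_restrict.1 hs).2)
  have h₃ := h₁.trans ((Shuffle.of_perm hq.symm h₂).append_left _)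
  refine ⟨h₃, fun i hi => ?_⟩
  have h₄ := (h₃.perm.pairwise_iff FloatRel.symm).1 h
  have hi' : (restrict (fun v => ¬ φ v) w).length + i <
      (restrict (fun v => ¬ φ v) w ++ q).length := by simpa using hi
  refine ⟨hi', fun k hk hne => ?_⟩
  have hφ : φ (restrict (fun v => ¬ φ v) w ++ q)[(restrict (fun v => ¬ φ v) w).length + i].1 := by
    rw [List.getElem_append_right (by omega)]
    exact (mem_restrict.1 (hq.subset (List.getElem_mem _))).2
  rw [List.pairwise_iff_getElem] at h₄
  rcases Nat.lt_or_gt_of_ne hne with hlt | hlt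
  · exact (h₄ _ _ _ _ hlt (Or.inr hφ)).symm
  · exact h₄ _ _ _ _ hlt (Or.inl hφ)

lemma exists_ofFn {α : Type*} {n : ℕ} (l : List α) (h : l.length = n) :
    ∃ f : Fin n → α, List.ofFn f = l := by
  subst h
  exact ⟨l.get, List.ofFn_get l⟩

end Floating

/-! ### From the combinatorial description back to conjugacy -/

section Converse

/-- The factor `z` stands for the floating part, which commutes with whatever prefix is rotated. -/
lemma CyclicMove.isConj {w w' : List (Syllable G)} (h : CyclicMove Γ G w w')
    {z : GraphProduct Γ G} (hz : ∀ s ∈ w, Commute z (of Γ G s.1 s.2)) :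
    IsConj (eval Γ G w * z) (eval Γ G w' * z) := by
  cases h with
  | swap l l' s t h =>
    rw [eval_append, eval_append, (Shuffle.swap h l').eval]
  | rotate l l' =>
    have hc : Commute z (eval Γ G l) := Commute.list_prod_right _ _ fun x hx => by
      obtain ⟨s, hs, rfl⟩ := List.mem_map.1 hx
      exact hz s (by simp [hs])
    refine isConj_iff.2 ⟨(eval Γ G l)⁻¹, ?_⟩
    simp only [eval_append, inv_inv, mul_assoc, inv_mul_cancel_left, hc.eq]

lemma CyclicallyRelated.isConj {w w' : List (Syllable G)} (h : CyclicallyRelated Γ G w w')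
    {z : GraphProduct Γ G} (hz : ∀ s ∈ w, Commute z (of Γ G s.1 s.2)) :
    IsConj (eval Γ G w * z) (eval Γ G w' * z) := by
  induction h with
  | refl => exact .refl _
  | tail h' h ih =>
    exact ih.trans (h.isConj fun s hs => hz s ((CyclicallyRelated.perm h').mem_iff.2 hs))

/-- The syllables are conjugated one at a time, those already treated being absorbed into `z`.
Commutation with whole vertex-groups is required because the conjugators are arbitrary. -/
lemma isConj_mul_eval {p q : List (Syllable G)} (h : List.Forall₂ (ConjInVertexGroup G) p q)
    (hp : p.Pairwise fun s t => Γ.Adj s.1 t.1) {z : GraphProduct Γ G}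
    (hz : ∀ s ∈ p, ∀ g : G s.1, Commute z (of Γ G s.1 g)) :
    IsConj (z * eval Γ G p) (z * eval Γ G q) := by
  induction h generalizing z with
  | nil => exact .refl _
  | @cons s t p q hst _ ih =>
    obtain ⟨u, g, k, rfl, rfl, hgk⟩ := hst
    obtain ⟨c, rfl⟩ := isConj_iff.1 hgk
    obtain ⟨h₁, h₂⟩ := List.pairwise_cons.1 hp
    have hz' := hz _ List.mem_cons_self
    simp only [eval_cons, ← mul_assoc]
    refine IsConj.trans (isConj_iff.2 ⟨of Γ G u c, ?_⟩) (ih h₂ (fun s hs g => ?_))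
    · have e₁ : Commute (of Γ G u c⁻¹) (eval Γ G p) := commute_eval _ h₁
      calc of Γ G u c * (z * of Γ G u g * eval Γ G p) * (of Γ G u c)⁻¹
          = (of Γ G u c * z) * of Γ G u g * (eval Γ G p * of Γ G u c⁻¹) := by
            simp [mul_assoc]
        _ = (z * of Γ G u c) * of Γ G u g * (of Γ G u c⁻¹ * eval Γ G p) := by
            rw [(hz' c).eq, e₁.eq]
        _ = z * of Γ G u (c * g * c⁻¹) * eval Γ G p := by simp [mul_assoc]
    · exact (hz s (by simp [hs]) g).mul_left (commute_of (h₁ s hs) _ _)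

lemma adj_of_isFloating_ofFn {r n : ℕ} {x : Fin r → Syllable G} {p : Fin n → Syllable G}
    {i : Fin n} (h : IsFloating Γ G (List.ofFn x ++ List.ofFn p) (r + i)) :
    (∀ s ∈ List.ofFn x, Γ.Adj (p i).1 s.1) ∧ ∀ j, j ≠ i → Γ.Adj (p i).1 (p j).1 := by
  obtain ⟨_, h⟩ := h
  constructor
  · intro s hs
    obtain ⟨j, rfl⟩ := List.mem_ofFn.1 hs
    have := h j (by simp; omega) (by omega)
    rw [List.getElem_append_right (by simp), List.getElem_append_left (by simp)] at this
    simpa using this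
  · intro j hj
    have := h (r + j) (by simp) (by omega)
    rw [List.getElem_append_right (by simp), List.getElem_append_right (by simp)] at this
    simpa using this

end Converse

end GraphProduct

/-! ### The conjugacy criterion -/

theorem mainTheorem3 {V : Type u} (Γ : SimpleGraph V) (G : V → Type v) [∀ u, Group (G u)]
    (a b : GraphProduct Γ G)
    (ha : GraphProduct.IsGraphicallyCyclicallyReducedElement Γ G a)
    (hb : GraphProduct.IsGraphicallyCyclicallyReducedElement Γ G b) :
    IsConj a b ↔
      ∃ (r n : ℕ) (x y : Fin r → GraphProduct.Syllable G) (p q : Fin n → GraphProduct.Syllable G),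
        GraphProduct.IsGraphicallyReduced Γ G (List.ofFn x ++ List.ofFn p) ∧
        GraphProduct.IsGraphicallyReduced Γ G (List.ofFn y ++ List.ofFn q) ∧
        a = GraphProduct.eval Γ G (List.ofFn x ++ List.ofFn p) ∧
        b = GraphProduct.eval Γ G (List.ofFn y ++ List.ofFn q) ∧
        (∀ i : Fin n, GraphProduct.IsFloating Γ G (List.ofFn x ++ List.ofFn p) (r + i)) ∧
        (∀ i : Fin n, GraphProduct.IsFloating Γ G (List.ofFn y ++ List.ofFn q) (r + i)) ∧
        (∃ σ : Equiv.Perm (Fin n), ∀ i : Fin n,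
          GraphProduct.ConjInVertexGroup G (p i) (q (σ i))) ∧
        GraphProduct.CyclicallyRelated Γ G (List.ofFn x) (List.ofFn y) := by
  open GraphProduct in
  constructor
  · intro hab
    obtain ⟨hv, hcyc, hperm⟩ := restrict_of_wordMoves
      (GraphProduct.IsConj.wordMove hab ha.isLocMin hb.isLocMin)
    have hpa := pairwise_floatRel (Γ := Γ) (word a)
    have hpb := pairwise_floatRel (Γ := Γ) (word b)
    rw [← hv] at hpb
    generalize FloatsIn Γ (vertices (word a)) = φ at hcyc hperm hpa hpb
    -- The permutation of conjugacy classes is lifted to a reordering `q` of the floating syllables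
    -- of `word b` matching those of `word a` term by term, so the identity can serve as `σ`.
    obtain ⟨q, hpq, hq⟩ : ∃ q, List.Forall₂ (fun s t => syllableClass s = syllableClass t)
        (restrict φ (word a)) q ∧ q.Perm (restrict φ (word b)) := by
      obtain ⟨q, h₁, h₂⟩ := List.perm_comp_forall₂ (r := fun c s => c = syllableClass s) hperm
        (List.forall₂_map_left_iff.2 (List.forall₂_same.2 fun _ _ => rfl))
      exact ⟨q, List.forall₂_map_left_iff.1 h₁, h₂⟩
    obtain ⟨ha₁, ha₂⟩ := floating_normalization hpa (.refl _)
    obtain ⟨hb₁, hb₂⟩ := floating_normalization hpb hq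
    obtain ⟨p, hp⟩ := exists_ofFn (restrict φ (word a)) rfl
    obtain ⟨q, rfl⟩ := exists_ofFn q hpq.length_eq.symm
    obtain ⟨x, hx⟩ := exists_ofFn (restrict (fun v => ¬ φ v) (word a)) rfl
    obtain ⟨y, hy⟩ := exists_ofFn (restrict (fun v => ¬ φ v) (word b)) hcyc.perm.length_eq.symm
    refine ⟨_, _, x, y, p, q, ?_, ?_, ?_, ?_, ?_, ?_, ⟨1, fun i => ?_⟩, ?_⟩
    · rw [hx, hp]; exact (ha₁.red (red_word a)).isGraphicallyReduced
    · rw [hy]; exact (hb₁.red (red_word b)).isGraphicallyReduced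
    · rw [hx, hp, ← ha₁.eval, eval_word]
    · rw [hy, ← hb₁.eval, eval_word]
    · intro i; rw [hx, hp]; exact ha₂ i i.2
    · intro i
      have := hb₂ i (by simp)
      rw [hy]
      rwa [← hcyc.perm.length_eq] at this
    · have := (List.forall₂_iff_get.1 hpq).2 i (by simp) (by simp)
      have e : (restrict φ (word a)).get i = p i :=
        (List.getElem_of_eq hp.symm i.2).trans (List.getElem_ofFn _)
      rw [← e]
      exact conjInVertexGroup_of_eq (by simpa using this)
    · rwa [hx, hy]
  · rintro ⟨r, n, x, y, p, q, -, -, rfl, rfl, hp, hq, ⟨σ, hσ⟩, hcyc⟩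
    have hp' := fun i => adj_of_isFloating_ofFn (hp i)
    have hq' := fun i => adj_of_isFloating_ofFn (hq i)
    have h₁ : IsConj (eval Γ G (List.ofFn x) * eval Γ G (List.ofFn p))
        (eval Γ G (List.ofFn y) * eval Γ G (List.ofFn p)) := by
      refine hcyc.isConj fun s hs => (commute_eval s.2 fun t ht => ?_).symm
      obtain ⟨i, rfl⟩ := List.mem_ofFn.1 ht
      exact ((hp' i).1 s hs).symm
    have h₂ : IsConj (eval Γ G (List.ofFn y) * eval Γ G (List.ofFn p))
        (eval Γ G (List.ofFn y) * eval Γ G (List.ofFn (q ∘ σ))) := by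
      refine isConj_mul_eval (List.forall₂_iff_get.2 ⟨by simp, fun i hi _ => ?_⟩) ?_ ?_
      · simpa using hσ ⟨i, by simpa using hi⟩
      · exact List.pairwise_ofFn.2 fun i j hij => (hp' i).2 j hij.ne'
      · intro s hs g
        obtain ⟨i, rfl⟩ := List.mem_ofFn.1 hs
        exact (commute_eval g fun t ht => (hp' i).1 t (hcyc.perm.mem_iff.2 ht)).symm
    -- Floating syllables are pairwise adjacent, so reordering them by `σ` is a shuffle.
    have h₃ : eval Γ G (List.ofFn (q ∘ σ)) = eval Γ G (List.ofFn q) :=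
      (Shuffle.of_perm (σ.ofFn_comp_perm q) (List.pairwise_ofFn.2 fun i j hij =>
        (hq' _).2 _ (σ.injective.ne hij.ne'))).eval
    rw [eval_append, eval_append, ← h₃]
    exact h₁.trans h₂
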